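/- Let $\mathbb{K}$ be a field of characteristic $0$ and let $S=\mathbb{K}[x,y,z]$ with its standard grading and the degree reverse lexicographic term ordering $\mathrm{DegRevLex}$ with $x>y>z$. A graded $\mathbb{K}$-algebra $R=\bigoplus_{i\ge 0}R_i$ with $\dim_{\mathbb{K}}R_i<\infty$ has the strong Lefschetz property (SLP) if there is $\ell\in R_1$ such that the multiplication map $\times\ell^s\colon R_i\to R_{i+s}$ has full rank (that is, rank $\min\{\dim_{\mathbb{K}} R_i,\dim_{\mathbb{K}} R_{i+s}\}$) for all $i\ge 0$ and $s\ge 1$. For a homogeneous ideal $I$ of $S$, $\mathrm{rgin}(I)$ denotes the generic initial ideal of $I$ with respect to $\mathrm{DegRevLex}$, that is, the unique ideal $J$ for which there is a nonempty Zariski open set $U\subseteq \mathrm{GL}_3(\mathbb{K})$ such that the leading term ideal of $g(I)$ is $J$ for every $g\in U$. A monomial ideal $J$ of $S$ is an almost revlex ideal if, for every power-product $t$ in the minimal generating set of $J$, every power-product $t'$ with $\deg(t')=\deg(t)$ and $t'>_{\mathrm{DegRevLex}}t$ belongs to $J$. The Hilbert function of a homogeneous ideal $I$ is $d\mapsto\dim_{\mathbb{K}}I_d$.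 **Corollary.** Let $I$ be a homogeneous ideal of $S=\mathbb{K}[x,y,z]$ such that $S/I$ has the SLP. Then $\mathrm{rgin}(I)$ (exists and) is an almost revlex ideal, and it is uniquely determined by the Hilbert function of $I$: it is the only almost revlex ideal of $S$ with the same Hilbert function as $I$. In particular, if $I'$ is another homogeneous ideal of $S$ such that $S/I'$ has the SLP and $I'$ has the same Hilbert function as $I$, then $\mathrm{rgin}(I')=\mathrm{rgin}(I)$. -/

import Mathlib

open MvPolynomial
open scoped MonomialOrder

namespace Lefschetz

/-! ### The degree reverse lexicographic term ordering -/

/-- Exponent vectors in `n` variables, to be ordered by `DegRevLex`. -/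
def DegRevLex (n : ℕ) : Type := Fin n →₀ ℕ

namespace DegRevLex

noncomputable instance (n : ℕ) : AddCommMonoid (DegRevLex n) :=
  inferInstanceAs (AddCommMonoid (Fin n →₀ ℕ))

/-- The identity map to the type synonym. -/
noncomputable def of {n : ℕ} : (Fin n →₀ ℕ) ≃+ DegRevLex n := AddEquiv.refl (Fin n →₀ ℕ)

/-- Compare first the total degrees; ties are broken by the last variable whose exponents differ,
the larger exponent there giving the smaller power-product (see `degRevLex_lt_iff`). The two order
duals express `last variable first` and `larger exponent is smaller`. -/
noncomputable def key {n : ℕ} (a : DegRevLex n) : ℕ ×ₗ Lex ((Fin n)ᵒᵈ → ℕᵒᵈ) :=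
  toLex ((of.symm a).degree, toLex fun i => OrderDual.toDual (of.symm a (OrderDual.ofDual i)))

theorem key_injective {n : ℕ} : Function.Injective (key (n := n)) := by
  intro a b h
  have h2 := congrArg (fun p => ofLex (ofLex p).2) h
  exact of.symm.injective (Finsupp.ext fun i => congrFun h2 (OrderDual.toDual i))

noncomputable instance (n : ℕ) : LinearOrder (DegRevLex n) :=
  LinearOrder.lift' key key_injective

theorem lt_iff {n : ℕ} (a b : Fin n →₀ ℕ) :
    of a < of b ↔
      a.degree < b.degree ∨
        a.degree = b.degree ∧ ∃ i, (∀ j, i < j → a j = b j) ∧ b i < a i := by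
  change key (of a) < key (of b) ↔ _
  simp only [key, Prod.Lex.toLex_lt_toLex]
  exact Iff.rfl

instance (n : ℕ) : IsOrderedAddMonoid (DegRevLex n) where
  add_le_add_left a b h c := by
    obtain ⟨a, rfl⟩ := of.surjective a
    obtain ⟨b, rfl⟩ := of.surjective b
    obtain ⟨c, rfl⟩ := of.surjective c
    rcases h.lt_or_eq with h | h
    · refine le_of_lt ?_
      rw [← map_add, ← map_add]
      rw [lt_iff] at h ⊢
      simpa only [map_add, Finsupp.add_apply, add_lt_add_iff_right, add_left_inj] using h
    · rw [h]

theorem of_mono {n : ℕ} : Monotone (of (n := n)) := by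
  intro a b h
  rcases eq_or_ne a b with rfl | hne
  · exact le_refl _
  · refine le_of_lt ((lt_iff a b).2 (Or.inl ?_))
    obtain ⟨c, rfl⟩ := exists_add_of_le h
    have hc : c.degree ≠ 0 := fun h0 => hne (by simp [(Finsupp.degree_eq_zero_iff c).1 h0])
    rw [map_add]
    omega

instance (n : ℕ) : WellFoundedLT (DegRevLex n) := by
  refine ⟨RelEmbedding.wellFounded_iff_isEmpty.2 ⟨fun f => ?_⟩⟩
  obtain ⟨i, j, hij, h⟩ := wellQuasiOrdered_le (α := Fin n →₀ ℕ) (fun k => of.symm (f k))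
  have h' := of_mono h
  simp only [AddEquiv.apply_symm_apply] at h'
  exact absurd h' (not_le_of_gt (f.map_rel_iff.2 hij))

end DegRevLex

/-- The degree reverse lexicographic term ordering on the power-products in `n` variables,
with `X 0 > X 1 > ⋯ > X (n - 1)`. -/
noncomputable def degRevLex (n : ℕ) : MonomialOrder (Fin n) where
  syn := DegRevLex n
  toSyn := DegRevLex.of
  toSyn_monotone := DegRevLex.of_mono

theorem degRevLex_lt_iff {n : ℕ} (a b : Fin n →₀ ℕ) :
    a ≺[degRevLex n] b ↔
      a.degree < b.degree ∨
        a.degree = b.degree ∧ ∃ i, (∀ j, i < j → a j = b j) ∧ b i < a i :=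
  DegRevLex.lt_iff a b

variable {K : Type*} [Field K] {n : ℕ}

/-! ### Leading term ideals and generic initial ideals -/

/-- The leading term ideal of `I`, generated by the power-products `LT(f)` for nonzero `f ∈ I`. -/
noncomputable def leadingTermIdeal (m : MonomialOrder (Fin n))
    (I : Ideal (MvPolynomial (Fin n) K)) : Ideal (MvPolynomial (Fin n) K) :=
  Ideal.span {p | ∃ f ∈ I, f ≠ 0 ∧ p = monomial (m.degree f) 1}

/-- The linear change of coordinates `x_i ↦ ∑ j, g i j * x_j`. -/
noncomputable def coordChange (g : GL (Fin n) K) :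
    MvPolynomial (Fin n) K →ₐ[K] MvPolynomial (Fin n) K :=
  aeval fun i => ∑ j, C (g i j) * X j

/-- Zariski open subsets of `GL n K`: complements of the common zero sets of families of
polynomials in the matrix entries. -/
def IsZariskiOpen (U : Set (GL (Fin n) K)) : Prop :=
  ∃ P : Set (MvPolynomial (Fin n × Fin n) K),
    U = {g | ∃ p ∈ P, eval (fun ij : Fin n × Fin n => g ij.1 ij.2) p ≠ 0}

/-- `J` is the generic initial ideal of `I`: it is the leading term ideal of `g(I)` for all `g` in
some nonempty Zariski open subset of `GL n K`. -/
def IsGin (m : MonomialOrder (Fin n)) (I J : Ideal (MvPolynomial (Fin n) K)) : Prop :=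
  ∃ U : Set (GL (Fin n) K), IsZariskiOpen U ∧ U.Nonempty ∧
    ∀ g ∈ U, leadingTermIdeal m (I.map (coordChange g)) = J

open Classical in
/-- The generic initial ideal with respect to `DegRevLex`. (The value `⊥` is only used if there is
no generic initial ideal.) -/
noncomputable def rgin (I : Ideal (MvPolynomial (Fin n) K)) : Ideal (MvPolynomial (Fin n) K) :=
  if h : ∃ J, IsGin (degRevLex n) I J then h.choose else ⊥

/-! ### Almost revlex ideals -/

/-- Ideals generated by power-products. -/
def IsMonomialIdeal (I : Ideal (MvPolynomial (Fin n) K)) : Prop :=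
  ∃ A : Set (Fin n →₀ ℕ), I = Ideal.span ((fun a => monomial a (1 : K)) '' A)

/-- The power-product with exponent `t` is in the minimal generating set of the monomial ideal `I`:
it is in `I` and no proper divisor of it is. -/
def IsMinimalGenerator (I : Ideal (MvPolynomial (Fin n) K)) (t : Fin n →₀ ℕ) : Prop :=
  Minimal (fun a => monomial a (1 : K) ∈ I) t

/-- Almost revlex ideals. -/
def IsAlmostRevlex (I : Ideal (MvPolynomial (Fin n) K)) : Prop :=
  IsMonomialIdeal I ∧ ∀ t, IsMinimalGenerator I t →
    ∀ t' : Fin n →₀ ℕ, t'.degree = t.degree → t ≺[degRevLex n] t' → monomial t' (1 : K) ∈ I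

/-! ### Hilbert functions and the strong Lefschetz property -/

/-- The Hilbert function `d ↦ dim_K I_d` of a homogeneous ideal. -/
noncomputable def hilbertFunction (I : Ideal (MvPolynomial (Fin n) K)) (d : ℕ) : ℕ :=
  Module.finrank K
    ↥(I.restrictScalars K ⊓ homogeneousSubmodule (Fin n) K d : Submodule K (MvPolynomial (Fin n) K))

/-- The homogeneous component of degree `i` of `S / I`, the image of that of `S`. -/
noncomputable def quotientComponent (I : Ideal (MvPolynomial (Fin n) K)) (i : ℕ) :
    Submodule K (MvPolynomial (Fin n) K ⧸ I) :=
  (homogeneousSubmodule (Fin n) K i).map (Ideal.Quotient.mkₐ K I).toLinearMap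

/-- The strong Lefschetz property of a `K`-algebra with (finite-dimensional) homogeneous components
`R i`: for some `ℓ ∈ R 1`, multiplication by `ℓ ^ s` from `R i` to `R (i + s)` has full rank, i.e.
its image has the smaller one of the two dimensions, for all `i ≥ 0` and `s ≥ 1`. -/
def HasSLP {A : Type*} [CommRing A] [Algebra K A] (R : ℕ → Submodule K A) : Prop :=
  ∃ ℓ ∈ R 1, ∀ i s : ℕ, 1 ≤ s →
    Module.finrank K ↥((R i).map (LinearMap.mulLeft K (ℓ ^ s))) =
      min (Module.finrank K (R i)) (Module.finrank K (R (i + s)))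

end Lefschetz

-- The standard grading of the polynomial ring, used for homogeneous ideals.
attribute [local instance] MvPolynomial.gradedAlgebra

/-! Existence of `rgin` is a specialization argument. Transform `I` by a matrix of indeterminates,
over the polynomial ring in the matrix entries. Its finitely many minimal leading exponents survive
wherever their leading coefficients do not vanish (`exists_forall_initialSet_subset`), and counting
degree by degree leaves no room for further ones (`exists_isGin`).

An almost revlex ideal is determined by its Hilbert function
(`IsAlmostRevlex.eq_of_hilbertFunction_eq`): in the first degree where two such ideals differ, each
has a monomial missing from the other. Both monomials are minimal generators, so the larger one is
forced into the ideal it was missing from.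

It remains to see that `rgin I` is almost revlex (`isAlmostRevlex_of_isGin`). Let `t = x^a y^b z^c`
be a minimal generator and `t' > t` of the same degree. If `t'` has smaller `z`-exponent, the SLP in
general coordinates makes multiplication by `z^c` from degree `a + b` injective or surjective.
Injectivity would put `t / z^c` in the ideal, against minimality; surjectivity puts in every
monomial of that degree with `z`-exponent below `c` (`MulPowFullRank.initialSet`). If the
`z`-exponents agree, a general substitution `y ↦ y + p x` and a Wronskian argument in characteristic
zero show that the `y`-exponents in a given degree with a given `z`-exponent form an initial segment
of `ℕ` (`mem_of_generic_of_le`). -/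

namespace Lefschetz

/-! ### Leading exponents over a commutative ring. -/

section InitialSet

variable {R : Type*} [CommRing R] {n : ℕ}

/-- The exponents of the leading terms of the nonzero elements of `I`. -/
def initialSet (I : Ideal (MvPolynomial (Fin n) R)) : Set (Fin n →₀ ℕ) :=
  {t | ∃ f ∈ I, f ≠ 0 ∧ (degRevLex n).degree f = t}

theorem coeff_ne_zero_of_degree_eq {f : MvPolynomial (Fin n) R} (hf : f ≠ 0) {t : Fin n →₀ ℕ}
    (h : (degRevLex n).degree f = t) : f.coeff t ≠ 0 :=
  h ▸ (degRevLex n).coeff_degree_ne_zero_iff.2 hf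

theorem coeff_eq_zero_of_degree_lt {f : MvPolynomial (Fin n) R} {t u : Fin n →₀ ℕ}
    (h : (degRevLex n).degree f = t) (hu : t ≺[degRevLex n] u) : f.coeff u = 0 :=
  (degRevLex n).coeff_eq_zero_of_lt (h.symm ▸ hu)

theorem degree_eq_of_coeff {f : MvPolynomial (Fin n) R} {t : Fin n →₀ ℕ} (ht : f.coeff t ≠ 0)
    (h : ∀ u, f.coeff u ≠ 0 → u ≼[degRevLex n] t) : (degRevLex n).degree f = t := by
  apply (degRevLex n).toSyn.injective
  apply le_antisymm
  · exact (degRevLex n).degree_le_iff.2 fun u hu => h u (mem_support_iff.1 hu)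
  · exact (degRevLex n).le_degree (mem_support_iff.2 ht)

theorem isUpperSet_initialSet (I : Ideal (MvPolynomial (Fin n) R)) :
    IsUpperSet (initialSet I) := by
  rintro t u htu ⟨f, hf, hf0, hft⟩
  obtain ⟨v, rfl⟩ := exists_add_of_le htu
  have : Nontrivial R := by
    by_contra h
    rw [not_nontrivial_iff_subsingleton] at h
    exact hf0 (Subsingleton.elim _ _)
  have hc : coeff (t + v) (f * monomial v (1 : R)) ≠ 0 := by
    rw [coeff_mul_monomial, mul_one]
    exact coeff_ne_zero_of_degree_eq hf0 hft
  refine ⟨f * monomial v 1, I.mul_mem_right _ hf, fun h => hc (by rw [h, coeff_zero]), ?_⟩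
  refine degree_eq_of_coeff hc fun w hw => ?_
  rw [coeff_mul_monomial'] at hw
  split_ifs at hw with hvw
  · obtain ⟨u, rfl⟩ := exists_add_of_le hvw
    rw [add_tsub_cancel_left, mul_one] at hw
    have h1 := (degRevLex n).le_degree (mem_support_iff.2 hw)
    rw [hft] at h1
    rw [add_comm v u, map_add, map_add]
    exact add_le_add_left h1 _
  · exact absurd rfl hw

theorem exists_isHomogeneous_of_mem_initialSet {I : Ideal (MvPolynomial (Fin n) R)}
    (hI : I.IsHomogeneous (homogeneousSubmodule (Fin n) R)) {t : Fin n →₀ ℕ}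
    (ht : t ∈ initialSet I) :
    ∃ f ∈ I, f.IsHomogeneous t.degree ∧ f ≠ 0 ∧ (degRevLex n).degree f = t := by
  obtain ⟨f, hf, hf0, hft⟩ := ht
  have hc : coeff t (homogeneousComponent t.degree f) ≠ 0 := by
    rw [coeff_homogeneousComponent, if_pos rfl]
    exact coeff_ne_zero_of_degree_eq hf0 hft
  refine ⟨homogeneousComponent t.degree f, homogeneousComponent_mem_of_mem hI hf _,
    homogeneousComponent_isHomogeneous _ _, fun h => hc (by rw [h, coeff_zero]), ?_⟩
  refine degree_eq_of_coeff hc fun u hu => ?_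
  rw [coeff_homogeneousComponent] at hu
  split_ifs at hu with h
  · exact hft ▸ (degRevLex n).le_degree (mem_support_iff.2 hu)
  · exact absurd rfl hu

theorem degree_degree_of_isHomogeneous {f : MvPolynomial (Fin n) R} {d : ℕ}
    (hf : f.IsHomogeneous d) (hf0 : f ≠ 0) : ((degRevLex n).degree f).degree = d := by
  by_contra h
  exact coeff_ne_zero_of_degree_eq hf0 rfl (hf.coeff_eq_zero h)

/-- Linearly independent forms of degree `d` in an ideal are at most as many as there are leading
terms of degree `d`, over any coefficient ring. -/
theorem card_le_ncard_initialSet [Nontrivial R] (I : Ideal (MvPolynomial (Fin n) R)) {d k : ℕ}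
    (v : Fin k → MvPolynomial (Fin n) R) (hv : LinearIndependent R v) (hI : ∀ i, v i ∈ I)
    (hd : ∀ i, (v i).IsHomogeneous d) : k ≤ (initialSet I ∩ {t | t.degree = d}).ncard := by
  have hfin : (initialSet I ∩ {t | t.degree = d}).Finite :=
    (Finsupp.finite_of_degree_eq d).subset Set.inter_subset_right
  have := hfin.fintype
  rw [Set.ncard_eq_toFinset_card', Set.toFinset_card]
  -- `L` reads off the coefficients of a combination at the leading exponents. A nonzero combination
  -- has its own leading exponent among these, so `L` is injective, which bounds `k` without passing
  -- to a fraction field.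
  let L : (Fin k → R) →ₗ[R] (↥(initialSet I ∩ {t | t.degree = d}) → R) :=
    (LinearMap.pi fun t => lcoeff R t.1) ∘ₗ Fintype.linearCombination R v
  have hL : Function.Injective L := by
    rw [injective_iff_map_eq_zero]
    intro c hc
    by_contra hne
    have hF0 : Fintype.linearCombination R v c ≠ 0 := fun h0 =>
      hne (funext (Fintype.linearIndependent_iff.1 hv c h0))
    set F := Fintype.linearCombination R v c with hF
    have hFI : F ∈ I := by
      rw [hF, Fintype.linearCombination_apply]
      exact I.sum_mem fun i _ => by
        rw [smul_eq_C_mul]; exact I.mul_mem_left _ (hI i)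
    have hFd : F.IsHomogeneous d := by
      rw [hF, Fintype.linearCombination_apply]
      exact (homogeneousSubmodule (Fin n) R d).sum_mem fun i _ =>
        (homogeneousSubmodule (Fin n) R d).smul_mem _ (hd i)
    have := congrFun hc ⟨(degRevLex n).degree F, ⟨F, hFI, hF0, rfl⟩,
      degree_degree_of_isHomogeneous hFd hF0⟩
    exact coeff_ne_zero_of_degree_eq hF0 rfl this
  simpa using card_le_of_injective R L hL

end InitialSet

/-! ### Hilbert functions as counts of leading exponents. -/

section Field

variable {K : Type*} [Field K] {n : ℕ}

/-- In a linear combination, the largest leading exponent among the terms with nonzero coefficient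
cannot cancel. -/
theorem linearIndependent_of_degree_injective {ι : Type*} (f : ι → MvPolynomial (Fin n) K)
    (hf0 : ∀ i, f i ≠ 0) (hinj : Function.Injective fun i => (degRevLex n).degree (f i)) :
    LinearIndependent K f := by
  classical
  rw [linearIndependent_iff']
  intro s g hg i hi
  by_contra hne
  obtain ⟨j, hj, hmax⟩ := (s.filter fun i => g i ≠ 0).exists_max_image
    (fun i => (degRevLex n).toSyn ((degRevLex n).degree (f i))) ⟨i, Finset.mem_filter.2 ⟨hi, hne⟩⟩
  rw [Finset.mem_filter] at hj
  have h := congrArg (coeff ((degRevLex n).degree (f j))) hg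
  rw [coeff_sum, Finset.sum_eq_single_of_mem j hj.1] at h
  · rw [coeff_smul, coeff_zero, smul_eq_mul, mul_eq_zero] at h
    exact h.elim hj.2 (coeff_ne_zero_of_degree_eq (hf0 j) rfl)
  · intro k hk hkj
    rw [coeff_smul, smul_eq_mul]
    by_cases hgk : g k = 0
    · rw [hgk, zero_mul]
    · rw [coeff_eq_zero_of_degree_lt rfl, mul_zero]
      refine lt_of_le_of_ne (hmax k (Finset.mem_filter.2 ⟨hk, hgk⟩)) fun h => hkj ?_
      exact hinj ((degRevLex n).toSyn.injective h)

instance finiteDimensional_homogeneousSubmodule (d : ℕ) :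
    FiniteDimensional K (homogeneousSubmodule (Fin n) K d) :=
  Module.Finite.iff_fg.2 (homogeneousSubmodule_fg _ _ d)

instance finiteDimensional_inf_homogeneousSubmodule (V : Submodule K (MvPolynomial (Fin n) K))
    (d : ℕ) : FiniteDimensional K ↥(V ⊓ homogeneousSubmodule (Fin n) K d) :=
  Submodule.finiteDimensional_of_le (inf_le_right : _ ≤ homogeneousSubmodule (Fin n) K d)

theorem exists_linearIndependent_of_hilbertFunction (I : Ideal (MvPolynomial (Fin n) K)) (d : ℕ) :
    ∃ v : Fin (hilbertFunction I d) → MvPolynomial (Fin n) K, LinearIndependent K v ∧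
      (∀ i, v i ∈ I) ∧ ∀ i, (v i).IsHomogeneous d := by
  let b := Module.finBasis K
    ↥(I.restrictScalars K ⊓ homogeneousSubmodule (Fin n) K d : Submodule K (MvPolynomial (Fin n) K))
  exact ⟨fun i => (b i).1, b.linearIndependent.map' (Submodule.subtype _) (Submodule.ker_subtype _),
    fun i => (b i).2.1, fun i => (b i).2.2⟩

/-- One form for each leading exponent gives an independent family; conversely, independent forms
are bounded by the number of leading exponents. -/
theorem hilbertFunction_eq_ncard {I : Ideal (MvPolynomial (Fin n) K)}
    (hI : I.IsHomogeneous (homogeneousSubmodule (Fin n) K)) (d : ℕ) :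
    hilbertFunction I d = (initialSet I ∩ {t | t.degree = d}).ncard := by
  apply le_antisymm
  · obtain ⟨v, hv, hvI, hvd⟩ := exists_linearIndependent_of_hilbertFunction I d
    exact card_le_ncard_initialSet I v hv hvI hvd
  · have hfin : (initialSet I ∩ {t | t.degree = d}).Finite :=
      (Finsupp.finite_of_degree_eq d).subset Set.inter_subset_right
    have := hfin.fintype
    have key : ∀ t : ↥(initialSet I ∩ {t | t.degree = d}), ∃ f :
        ↥(I.restrictScalars K ⊓ homogeneousSubmodule (Fin n) K d :
          Submodule K (MvPolynomial (Fin n) K)), f.1 ≠ 0 ∧ (degRevLex n).degree f.1 = t.1 := by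
      rintro ⟨t, ht, rfl⟩
      obtain ⟨f, hf, hfd, hf0, hft⟩ := exists_isHomogeneous_of_mem_initialSet hI ht
      exact ⟨⟨f, hf, hfd⟩, hf0, hft⟩
    choose f hf0 hft using key
    have hli : LinearIndependent K f := by
      refine LinearIndependent.of_comp (Submodule.subtype _) ?_
      refine linearIndependent_of_degree_injective _ hf0 fun s t hst => Subtype.ext ?_
      simpa [hft] using hst
    rw [Set.ncard_eq_toFinset_card', Set.toFinset_card]
    exact hli.fintype_card_le_finrank

theorem leadingTermIdeal_eq_span (I : Ideal (MvPolynomial (Fin n) K)) :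
    leadingTermIdeal (degRevLex n) I =
      Ideal.span ((fun a => monomial a (1 : K)) '' initialSet I) := by
  unfold leadingTermIdeal
  congr 1
  ext p
  constructor
  · rintro ⟨f, hf, hf0, rfl⟩
    exact ⟨_, ⟨f, hf, hf0, rfl⟩, rfl⟩
  · rintro ⟨_, ⟨f, hf, hf0, rfl⟩, rfl⟩
    exact ⟨f, hf, hf0, rfl⟩

theorem monomial_mem_span_iff {M : Set (Fin n →₀ ℕ)} (hM : IsUpperSet M) (t : Fin n →₀ ℕ) :
    monomial t (1 : K) ∈ Ideal.span ((fun a => monomial a (1 : K)) '' M) ↔ t ∈ M := by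
  classical
  rw [mem_ideal_span_monomial_image]
  simp only [support_monomial, one_ne_zero, if_false, Finset.mem_singleton, forall_eq]
  exact ⟨fun ⟨s, hs, hst⟩ => hM hst hs, fun h => ⟨t, h, le_rfl⟩⟩

theorem initialSet_span {M : Set (Fin n →₀ ℕ)} (hM : IsUpperSet M) :
    initialSet (Ideal.span ((fun a => monomial a (1 : K)) '' M)) = M := by
  ext t
  constructor
  · rintro ⟨f, hf, hf0, rfl⟩
    obtain ⟨s, hs, hst⟩ := mem_ideal_span_monomial_image.1 hf _
      ((degRevLex n).degree_mem_support hf0)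
    exact hM hst hs
  · intro ht
    refine ⟨monomial t 1, (monomial_mem_span_iff hM t).2 ht, by simp, ?_⟩
    classical
    rw [MonomialOrder.degree_monomial, if_neg one_ne_zero]

theorem isHomogeneous_span_monomial (M : Set (Fin n →₀ ℕ)) :
    (Ideal.span ((fun a => monomial a (1 : K)) '' M)).IsHomogeneous
      (homogeneousSubmodule (Fin n) K) := by
  apply Ideal.homogeneous_span
  rintro _ ⟨t, -, rfl⟩
  exact ⟨t.degree, isHomogeneous_monomial 1 rfl⟩

theorem isUpperSet_monomial_mem (J : Ideal (MvPolynomial (Fin n) K)) :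
    IsUpperSet {t | monomial t (1 : K) ∈ J} := by
  intro t u htu ht
  obtain ⟨v, rfl⟩ := exists_add_of_le htu
  have : monomial (t + v) (1 : K) = monomial t 1 * monomial v 1 := by
    rw [monomial_mul, mul_one]
  change monomial (t + v) (1 : K) ∈ J
  rw [this]
  exact J.mul_mem_right _ ht

theorem IsMonomialIdeal.eq_span {J : Ideal (MvPolynomial (Fin n) K)} (hJ : IsMonomialIdeal J) :
    J = Ideal.span ((fun a => monomial a (1 : K)) '' {t | monomial t (1 : K) ∈ J}) := by
  obtain ⟨A, hA⟩ := hJ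
  apply le_antisymm
  · conv_lhs => rw [hA]
    refine Ideal.span_mono (Set.image_mono fun t ht => ?_)
    change monomial t (1 : K) ∈ J
    rw [hA]
    exact Ideal.subset_span ⟨t, ht, rfl⟩
  · rw [Ideal.span_le]
    rintro _ ⟨t, ht, rfl⟩
    exact ht

theorem hilbertFunction_eq_ncard_monomial {J : Ideal (MvPolynomial (Fin n) K)}
    (hJ : IsMonomialIdeal J) (d : ℕ) :
    hilbertFunction J d = {t : Fin n →₀ ℕ | monomial t (1 : K) ∈ J ∧ t.degree = d}.ncard := by
  have hh : J.IsHomogeneous (homogeneousSubmodule (Fin n) K) := by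
    rw [hJ.eq_span]; exact isHomogeneous_span_monomial _
  have hM : initialSet J = {t | monomial t (1 : K) ∈ J} := by
    conv_lhs => rw [hJ.eq_span]
    exact initialSet_span (isUpperSet_monomial_mem J)
  rw [hilbertFunction_eq_ncard hh, hM]
  rfl

theorem hilbertFunction_leadingTermIdeal {I : Ideal (MvPolynomial (Fin n) K)}
    (hI : I.IsHomogeneous (homogeneousSubmodule (Fin n) K)) :
    hilbertFunction (leadingTermIdeal (degRevLex n) I) = hilbertFunction I := by
  funext d
  rw [hilbertFunction_eq_ncard hI, leadingTermIdeal_eq_span,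
    hilbertFunction_eq_ncard (isHomogeneous_span_monomial _),
    initialSet_span (isUpperSet_initialSet I)]

end Field

/-! ### Almost revlex ideals with equal Hilbert functions. -/

section Uniqueness

variable {K : Type*} [Field K] {n : ℕ}

theorem IsAlmostRevlex.eq_of_hilbertFunction_eq {J J' : Ideal (MvPolynomial (Fin n) K)}
    (hJ : IsAlmostRevlex J) (hJ' : IsAlmostRevlex J')
    (h : hilbertFunction J = hilbertFunction J') : J = J' := by
  -- If the ideals agree below the degree of `t`, a proper divisor of `t` in `A` would lie in `B`
  -- and drag `t` into `B`.
  have minimal_of_notMem : ∀ {A B : Ideal (MvPolynomial (Fin n) K)} {t : Fin n →₀ ℕ},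
      (∀ u : Fin n →₀ ℕ, u.degree < t.degree → (monomial u (1 : K) ∈ A ↔ monomial u (1 : K) ∈ B)) →
      monomial t (1 : K) ∈ A → monomial t (1 : K) ∉ B → IsMinimalGenerator A t := by
    intro A B t ih htA htB
    refine ⟨htA, fun u hu hut => ?_⟩
    by_contra hle
    obtain ⟨v, rfl⟩ := exists_add_of_le hut
    have hv : v.degree ≠ 0 := fun h0 => hle (by simp [(Finsupp.degree_eq_zero_iff v).1 h0])
    refine htB (isUpperSet_monomial_mem B hut ((ih u ?_).1 hu))
    rw [map_add]
    omega
  have key : ∀ d, ∀ t : Fin n →₀ ℕ, t.degree = d →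
      (monomial t (1 : K) ∈ J ↔ monomial t (1 : K) ∈ J') := by
    intro d
    induction d using Nat.strong_induction_on with
    | _ d ih =>
      set A := {t : Fin n →₀ ℕ | monomial t (1 : K) ∈ J ∧ t.degree = d} with hA
      set B := {t : Fin n →₀ ℕ | monomial t (1 : K) ∈ J' ∧ t.degree = d} with hB
      have hAfin : A.Finite := (Finsupp.finite_of_degree_eq d).subset fun t ht => ht.2
      have hBfin : B.Finite := (Finsupp.finite_of_degree_eq d).subset fun t ht => ht.2
      have hcard : A.ncard = B.ncard := by
        rw [hA, hB, ← hilbertFunction_eq_ncard_monomial hJ.1,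
          ← hilbertFunction_eq_ncard_monomial hJ'.1, h]
      suffices hAB : A = B by
        intro t ht
        have := Set.ext_iff.1 hAB t
        simpa [hA, hB, ht] using this
      by_contra hne
      obtain ⟨t, htA, htB⟩ : ∃ t ∈ A, t ∉ B := by
        by_contra! hsub
        exact hne (Set.eq_of_subset_of_ncard_le hsub hcard.ge hBfin)
      obtain ⟨u, huB, huA⟩ : ∃ u ∈ B, u ∉ A := by
        by_contra! hsub
        exact hne (Set.eq_of_subset_of_ncard_le hsub hcard.le hAfin).symm
      have htd := htA.2
      have hud := huB.2
      have htJ' : monomial t (1 : K) ∉ J' := fun h => htB ⟨h, htd⟩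
      have huJ : monomial u (1 : K) ∉ J := fun h => huA ⟨h, hud⟩
      rcases lt_trichotomy ((degRevLex n).toSyn t) ((degRevLex n).toSyn u) with hlt | heq | hlt
      · refine huJ (hJ.2 t (minimal_of_notMem ?_ htA.1 htJ') u (hud.trans htd.symm) hlt)
        exact fun v hv => ih _ (htd ▸ hv) v rfl
      · exact huJ ((degRevLex n).toSyn.injective heq ▸ htA.1)
      · refine htJ' (hJ'.2 u (minimal_of_notMem ?_ huB.1 huJ) t (htd.trans hud.symm) hlt)
        exact fun v hv => (ih _ (hud ▸ hv) v rfl).symm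
  rw [hJ.1.eq_span, hJ'.1.eq_span]
  congr 2
  ext t
  exact key _ t rfl

end Uniqueness

/-! ### The action of linear coordinate changes. -/

section CoordChange

variable {K : Type*} [Field K] {n : ℕ}

@[simp]
theorem coordChange_X (g : GL (Fin n) K) (i : Fin n) :
    coordChange g (X i) = ∑ j, C (g i j) * X j :=
  aeval_X _ _

@[simp]
theorem coordChange_C (g : GL (Fin n) K) (a : K) : coordChange g (C a) = C a :=
  aeval_C _ _

/-- The matrix acts on the variables, so composition reverses products; further coordinate changes
therefore multiply on the right. -/
theorem coordChange_coordChange (g h : GL (Fin n) K) (f : MvPolynomial (Fin n) K) :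
    coordChange g (coordChange h f) = coordChange (h * g) f := by
  have : (coordChange g).comp (coordChange h) = coordChange (h * g) := by
    refine MvPolynomial.algHom_ext fun i => ?_
    simp only [AlgHom.comp_apply, coordChange_X, map_sum, map_mul, coordChange_C, Finset.mul_sum,
      Units.val_mul, Matrix.mul_apply, Finset.sum_mul, mul_assoc]
    exact Finset.sum_comm
  exact DFunLike.congr_fun this f

theorem coordChange_one (f : MvPolynomial (Fin n) K) :
    coordChange (1 : GL (Fin n) K) f = f := by
  have : coordChange (1 : GL (Fin n) K) = AlgHom.id K _ := by
    refine MvPolynomial.algHom_ext fun i => ?_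
    simp [Matrix.one_apply]
  exact DFunLike.congr_fun this f

@[simp]
theorem coordChange_coordChange_inv (g : GL (Fin n) K) (f : MvPolynomial (Fin n) K) :
    coordChange g (coordChange g⁻¹ f) = f := by
  rw [coordChange_coordChange, inv_mul_cancel, coordChange_one]

@[simp]
theorem coordChange_inv_coordChange (g : GL (Fin n) K) (f : MvPolynomial (Fin n) K) :
    coordChange g⁻¹ (coordChange g f) = f := by
  rw [coordChange_coordChange, mul_inv_cancel, coordChange_one]

theorem coordChange_injective (g : GL (Fin n) K) : Function.Injective (coordChange g) :=
  Function.LeftInverse.injective (coordChange_inv_coordChange g)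

theorem isHomogeneous_coordChange (g : GL (Fin n) K) {f : MvPolynomial (Fin n) K} {d : ℕ}
    (hf : f.IsHomogeneous d) : (coordChange g f).IsHomogeneous d := by
  have := hf.aeval (fun i => ∑ j, C (g i j) * X j) (n := 1)
    fun i => IsHomogeneous.sum _ _ _ fun j _ => isHomogeneous_C_mul_X _ _
  rwa [one_mul] at this

theorem mem_map_coordChange {g : GL (Fin n) K} {I : Ideal (MvPolynomial (Fin n) K)}
    {F : MvPolynomial (Fin n) K} : F ∈ I.map (coordChange g) ↔ ∃ f ∈ I, coordChange g f = F :=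
  Ideal.mem_map_iff_of_surjective _
    (Function.RightInverse.surjective (coordChange_coordChange_inv g))

theorem coordChange_mem_map {g : GL (Fin n) K} {I : Ideal (MvPolynomial (Fin n) K)}
    {f : MvPolynomial (Fin n) K} : coordChange g f ∈ I.map (coordChange g) ↔ f ∈ I := by
  rw [mem_map_coordChange]
  exact ⟨fun ⟨f', hf', h⟩ => coordChange_injective g h ▸ hf', fun h => ⟨f, h, rfl⟩⟩

theorem map_coordChange_mul (g h : GL (Fin n) K) (I : Ideal (MvPolynomial (Fin n) K)) :
    I.map (coordChange (g * h)) = (I.map (coordChange g)).map (coordChange h) := by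
  rw [Ideal.map_mapₐ]
  congr 1
  exact AlgHom.ext fun f => (coordChange_coordChange h g f).symm

/-- Ring homomorphisms preserving degrees of forms map homogeneous ideals to such ideals. -/
theorem isHomogeneous_map {A : Type*} [CommRing A] [Algebra K A]
    (Φ : MvPolynomial (Fin n) K →ₐ[K] MvPolynomial (Fin n) A)
    (hΦ : ∀ f d, f.IsHomogeneous d → (Φ f).IsHomogeneous d) {I : Ideal (MvPolynomial (Fin n) K)}
    (hI : I.IsHomogeneous (homogeneousSubmodule (Fin n) K)) :
    (I.map Φ).IsHomogeneous (homogeneousSubmodule (Fin n) A) := by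
  obtain ⟨S, rfl⟩ := (Ideal.IsHomogeneous.iff_exists _ _).1 hI
  rw [Ideal.map_span]
  apply Ideal.homogeneous_span
  rintro _ ⟨_, ⟨⟨f, d, hf⟩, -, rfl⟩, rfl⟩
  exact ⟨d, hΦ f d hf⟩

theorem isHomogeneous_map_coordChange (g : GL (Fin n) K) {I : Ideal (MvPolynomial (Fin n) K)}
    (hI : I.IsHomogeneous (homogeneousSubmodule (Fin n) K)) :
    (I.map (coordChange g)).IsHomogeneous (homogeneousSubmodule (Fin n) K) :=
  isHomogeneous_map _ (fun _ _ h => isHomogeneous_coordChange g h) hI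

theorem hilbertFunction_map_coordChange (g : GL (Fin n) K) (I : Ideal (MvPolynomial (Fin n) K)) :
    hilbertFunction (I.map (coordChange g)) = hilbertFunction I := by
  funext d
  have hmap : ((I.map (coordChange g)).restrictScalars K ⊓ homogeneousSubmodule (Fin n) K d :
      Submodule K (MvPolynomial (Fin n) K)) =
      (I.restrictScalars K ⊓ homogeneousSubmodule (Fin n) K d :
        Submodule K (MvPolynomial (Fin n) K)).map (coordChange g).toLinearMap := by
    ext F
    constructor
    · rintro ⟨hF, hFd⟩
      obtain ⟨f, hf, rfl⟩ := mem_map_coordChange.1 hF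
      refine ⟨f, ⟨hf, ?_⟩, rfl⟩
      have := isHomogeneous_coordChange g⁻¹ hFd
      rwa [coordChange_inv_coordChange] at this
    · rintro ⟨f, ⟨hf, hfd⟩, rfl⟩
      exact ⟨coordChange_mem_map.2 hf, isHomogeneous_coordChange g hfd⟩
  unfold hilbertFunction
  rw [hmap]
  exact (Submodule.equivMapOfInjective (coordChange g).toLinearMap
    (coordChange_injective g) _).finrank_eq.symm

end CoordChange

/-! ### Nonempty Zariski open sets meet. -/

section Zariski

variable {K : Type*} [Field K] [Infinite K] {n : ℕ}

/-- Multiplying by the determinant turns a nonzero value at some matrix into one at an invertible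
matrix. -/
theorem exists_eval_ne_zero_of_ne_zero {P : MvPolynomial (Fin n × Fin n) K} (hP : P ≠ 0) :
    ∃ g : GL (Fin n) K, eval (fun ij : Fin n × Fin n => g ij.1 ij.2) P ≠ 0 := by
  have hne : P * (Matrix.mvPolynomialX (Fin n) (Fin n) K).det ≠ 0 :=
    mul_ne_zero hP (Matrix.det_mvPolynomialX_ne_zero _ _)
  obtain ⟨s, hs⟩ : ∃ s, eval s (P * (Matrix.mvPolynomialX (Fin n) (Fin n) K).det) ≠ 0 := by
    by_contra! h
    exact hne (MvPolynomial.funext fun s => by rw [h s, map_zero])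
  rw [map_mul, Matrix.eval_det_mvPolynomialX] at hs
  exact ⟨Matrix.GeneralLinearGroup.mkOfDetNeZero _ (right_ne_zero_of_mul hs),
    left_ne_zero_of_mul hs⟩

theorem exists_mem_inter_of_isZariskiOpen {U V : Set (GL (Fin n) K)} (hU : IsZariskiOpen U)
    (hV : IsZariskiOpen V) (hU' : U.Nonempty) (hV' : V.Nonempty) : (U ∩ V).Nonempty := by
  obtain ⟨P, rfl⟩ := hU
  obtain ⟨Q, rfl⟩ := hV
  obtain ⟨g, p, hp, hgp⟩ := hU'
  obtain ⟨h, q, hq, hhq⟩ := hV'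
  have hpq : p * q ≠ 0 :=
    mul_ne_zero (fun h0 => hgp (by rw [h0, map_zero])) (fun h0 => hhq (by rw [h0, map_zero]))
  obtain ⟨k, hk⟩ := exists_eval_ne_zero_of_ne_zero hpq
  rw [map_mul] at hk
  exact ⟨k, ⟨p, hp, left_ne_zero_of_mul hk⟩, ⟨q, hq, right_ne_zero_of_mul hk⟩⟩

theorem IsGin.unique {m : MonomialOrder (Fin n)} {I J J' : Ideal (MvPolynomial (Fin n) K)}
    (h : IsGin m I J) (h' : IsGin m I J') : J = J' := by
  obtain ⟨U, hU, hUn, hUJ⟩ := h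
  obtain ⟨V, hV, hVn, hVJ⟩ := h'
  obtain ⟨g, hgU, hgV⟩ := exists_mem_inter_of_isZariskiOpen hU hV hUn hVn
  rw [← hUJ g hgU, hVJ g hgV]

end Zariski

/-! ### Existence of the generic initial ideal. -/

section Existence

variable {K : Type*} [Field K] {n : ℕ}

/-- The change of coordinates given by the matrix of indeterminates. -/
noncomputable def genericCoordChange (K : Type*) [Field K] (n : ℕ) :
    MvPolynomial (Fin n) K →ₐ[K] MvPolynomial (Fin n) (MvPolynomial (Fin n × Fin n) K) :=
  aeval fun i => ∑ j, C (X (i, j)) * X j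

theorem map_genericCoordChange (g : GL (Fin n) K) (f : MvPolynomial (Fin n) K) :
    map (eval fun ij : Fin n × Fin n => g ij.1 ij.2) (genericCoordChange K n f) =
      coordChange g f := by
  have : (MvPolynomial.mapAlgHom (MvPolynomial.aeval fun ij : Fin n × Fin n => g ij.1 ij.2)).comp
      (genericCoordChange K n) = coordChange g := by
    refine MvPolynomial.algHom_ext fun i => ?_
    simp [genericCoordChange]
  exact DFunLike.congr_fun this f

theorem isHomogeneous_genericCoordChange {f : MvPolynomial (Fin n) K} {d : ℕ}
    (hf : f.IsHomogeneous d) : (genericCoordChange K n f).IsHomogeneous d := by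
  have := hf.aeval (fun i => ∑ j, C (X (i, j) : MvPolynomial (Fin n × Fin n) K) * X j) (n := 1)
    fun i => IsHomogeneous.sum _ _ _ fun j _ => isHomogeneous_C_mul_X _ _
  rwa [one_mul] at this

theorem map_mem_map_coordChange (g : GL (Fin n) K) {I : Ideal (MvPolynomial (Fin n) K)}
    {F : MvPolynomial (Fin n) (MvPolynomial (Fin n × Fin n) K)}
    (hF : F ∈ I.map (genericCoordChange K n)) :
    map (eval fun ij : Fin n × Fin n => g ij.1 ij.2) F ∈ I.map (coordChange g) := by
  have hle : I.map (genericCoordChange K n) ≤ (I.map (coordChange g)).comap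
      (map (eval fun ij : Fin n × Fin n => g ij.1 ij.2)) := by
    rw [Ideal.map_le_iff_le_comap]
    intro f hf
    rw [Ideal.mem_comap, Ideal.mem_comap, map_genericCoordChange]
    exact Ideal.mem_map_of_mem _ hf
  exact hle hF

/-- A relation with a nonzero coefficient specializes, at a matrix where that coefficient does not
vanish, to a nontrivial relation after an invertible coordinate change. -/
theorem linearIndependent_genericCoordChange [Infinite K] {k : ℕ}
    {v : Fin k → MvPolynomial (Fin n) K} (hv : LinearIndependent K v) :
    LinearIndependent (MvPolynomial (Fin n × Fin n) K) fun i => genericCoordChange K n (v i) := by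
  rw [Fintype.linearIndependent_iff]
  intro a ha i
  by_contra hi
  obtain ⟨g, hg⟩ := exists_eval_ne_zero_of_ne_zero hi
  have h := congrArg (map (eval fun ij : Fin n × Fin n => g ij.1 ij.2)) ha
  simp only [map_sum, smul_eq_C_mul, map_mul, map_C, map_genericCoordChange, map_zero] at h
  have hli : LinearIndependent K fun i => coordChange g (v i) :=
    hv.map' (coordChange g).toLinearMap (LinearMap.ker_eq_bot.2 (coordChange_injective g))
  refine hg (Fintype.linearIndependent_iff.1 hli
    (fun i => eval (fun ij : Fin n × Fin n => g ij.1 ij.2) (a i)) ?_ i)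
  simpa only [smul_eq_C_mul] using h

theorem exists_forall_initialSet_subset (I : Ideal (MvPolynomial (Fin n) K)) :
    ∃ P : MvPolynomial (Fin n × Fin n) K, P ≠ 0 ∧ ∀ g : GL (Fin n) K,
      eval (fun ij : Fin n × Fin n => g ij.1 ij.2) P ≠ 0 →
        initialSet (I.map (genericCoordChange K n)) ⊆ initialSet (I.map (coordChange g)) := by
  generalize hM : initialSet (I.map (genericCoordChange K n)) = M
  -- Dickson's lemma: finitely many leading coefficients have to be kept nonzero, so their product
  -- serves as `P`.
  have hfin : {t | Minimal (· ∈ M) t}.Finite :=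
    WellQuasiOrderedLE.finite_of_isAntichain (setOfPred_minimal_antichain (· ∈ M))
  have key : ∀ t, Minimal (· ∈ M) t →
      ∃ F ∈ I.map (genericCoordChange K n), F ≠ 0 ∧ (degRevLex n).degree F = t := by
    intro t ht
    have := ht.1
    rwa [← hM] at this
  choose! F hFI hF0 hFt using key
  refine ⟨∏ t ∈ hfin.toFinset, (F t).coeff t, ?_, ?_⟩
  · refine Finset.prod_ne_zero_iff.2 fun t ht => ?_
    have ht' : Minimal (· ∈ M) t := hfin.mem_toFinset.1 ht
    exact coeff_ne_zero_of_degree_eq (hF0 t ht') (hFt t ht')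
  intro g hg t ht
  obtain ⟨s, hst, hs⟩ := exists_minimal_le_of_wellFoundedLT (· ∈ M) t ht
  refine isUpperSet_initialSet _ hst ?_
  rw [map_prod, Finset.prod_ne_zero_iff] at hg
  have hc : coeff s (map (eval fun ij : Fin n × Fin n => g ij.1 ij.2) (F s)) ≠ 0 := by
    rw [coeff_map]
    exact hg s (hfin.mem_toFinset.2 hs)
  refine ⟨_, map_mem_map_coordChange g (hFI s hs), fun h0 => hc (by rw [h0, coeff_zero]),
    degree_eq_of_coeff hc fun u hu => ?_⟩
  rw [coeff_map] at hu
  have hu' : u ∈ (F s).support := mem_support_iff.2 fun h0 => hu (by rw [h0, map_zero])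
  have hle := (degRevLex n).le_degree hu'
  rwa [hFt s hs] at hle

/-- Galligo's theorem on the existence of generic initial ideals. -/
theorem exists_isGin [Infinite K] {I : Ideal (MvPolynomial (Fin n) K)}
    (hI : I.IsHomogeneous (homogeneousSubmodule (Fin n) K)) :
    ∃ J, IsGin (degRevLex n) I J := by
  obtain ⟨P, hP, hsub⟩ := exists_forall_initialSet_subset I
  refine ⟨Ideal.span ((fun a => monomial a (1 : K)) ''
      initialSet (I.map (genericCoordChange K n))),
    {g | eval (fun ij : Fin n × Fin n => g ij.1 ij.2) P ≠ 0}, ⟨{P}, by simp⟩,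
    exists_eval_ne_zero_of_ne_zero hP, fun g hg => ?_⟩
  rw [leadingTermIdeal_eq_span]
  congr 2
  refine (Set.Subset.antisymm (hsub g hg) fun t ht => ?_).symm
  -- The generic ideal contains as many independent forms of each degree as `I`, hence has at least
  -- as many leading exponents there as the specialization; the inclusion is an equality.
  have hslice : initialSet (I.map (genericCoordChange K n)) ∩ {u | u.degree = t.degree} =
      initialSet (I.map (coordChange g)) ∩ {u | u.degree = t.degree} := by
    refine Set.eq_of_subset_of_ncard_le (Set.inter_subset_inter_left _ (hsub g hg)) ?_
      ((Finsupp.finite_of_degree_eq _).subset Set.inter_subset_right)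
    rw [← hilbertFunction_eq_ncard (isHomogeneous_map_coordChange g hI),
      hilbertFunction_map_coordChange]
    obtain ⟨v, hv, hvI, hvd⟩ := exists_linearIndependent_of_hilbertFunction I t.degree
    exact card_le_ncard_initialSet _ _ (linearIndependent_genericCoordChange hv)
      (fun i => Ideal.mem_map_of_mem _ (hvI i)) fun i => isHomogeneous_genericCoordChange (hvd i)
  exact (hslice.ge ⟨ht, rfl⟩).1

theorem isGin_rgin [Infinite K] {I : Ideal (MvPolynomial (Fin n) K)}
    (hI : I.IsHomogeneous (homogeneousSubmodule (Fin n) K)) :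
    IsGin (degRevLex n) I (rgin I) := by
  have h := exists_isGin hI
  rw [rgin, dif_pos h]
  exact h.choose_spec

end Existence

end Lefschetz

namespace Polynomial

/-! ### Wronskians and one-parameter families. -/

section Univariate

variable {K : Type*} [Field K]

/-- If the Wronskian of `g` and `f` vanishes, then `f` has no zeros outside those of `g`. -/
theorem eq_zero_of_wronskian_eq_zero [CharZero K] {f g : K[X]} {p : K}
    (h : wronskian g f = 0) (hg : g.eval p ≠ 0) (hf : f.eval p = 0) : f = 0 := by
  by_contra hf0
  have hm : 0 < f.rootMultiplicity p := (rootMultiplicity_pos hf0).2 hf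
  have hdvd : (X - C p) ^ f.rootMultiplicity p ∣ g * derivative f := by
    rw [wronskian, sub_eq_zero] at h
    rw [h]
    exact (pow_rootMultiplicity_dvd f p).mul_left _
  have hcop : IsCoprime ((X - C p) ^ f.rootMultiplicity p) g := by
    refine IsCoprime.pow_left ?_
    rw [(irreducible_X_sub_C p).coprime_iff_not_dvd, dvd_iff_isRoot]
    exact hg
  -- The derivative is now divisible by the full power `(X - p) ^ m`, whereas in characteristic zero
  -- its multiplicity at `p` is only `m - 1`.
  have hdvd' := hcop.dvd_of_dvd_mul_left hdvd
  have hd0 : derivative f ≠ 0 := by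
    intro h0
    rw [eq_C_of_natDegree_eq_zero (derivative_eq_zero.1 h0), eval_C] at hf
    apply hf0
    rw [eq_C_of_natDegree_eq_zero (derivative_eq_zero.1 h0), hf, C_0]
  have hle := (le_rootMultiplicity_iff hd0).2 hdvd'
  rw [derivative_rootMultiplicity_of_root hf] at hle
  omega

/-- In characteristic zero, a `k`-dimensional space of polynomials contains no nonzero element
vanishing to order `k` at a general point. -/
theorem exists_forall_pow_dvd_imp_eq_zero [CharZero K] (k : ℕ) (V : Submodule K K[X])
    [FiniteDimensional K V] (hV : Module.finrank K V ≤ k) :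
    ∃ q : K[X], q ≠ 0 ∧ ∀ p, q.eval p ≠ 0 → ∀ f ∈ V, (X - C p) ^ k ∣ f → f = 0 := by
  induction k generalizing V with
  | zero =>
    have hbot : V = ⊥ := Submodule.finrank_eq_zero.1 (Nat.le_zero.1 hV)
    exact ⟨1, one_ne_zero, fun p _ f hf _ => by simpa [hbot] using hf⟩
  | succ k ih =>
    by_cases hbot : V = ⊥
    · exact ⟨1, one_ne_zero, fun p _ f hf _ => by simpa [hbot] using hf⟩
    obtain ⟨g, hgV, hg0⟩ := V.ne_bot_iff.1 hbot
    -- The Wronskian with a fixed `g ∈ V` kills `g`, so it lowers the dimension, and it lowers the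
    -- order of vanishing at `p` by at most one. The induction hypothesis applies to its range.
    let D : V →ₗ[K] K[X] := (wronskianBilin K g).domRestrict V
    have hlt : Module.finrank K (LinearMap.range D) < Module.finrank K V := by
      have hker : (⟨g, hgV⟩ : V) ∈ LinearMap.ker D := wronskian_self_eq_zero g
      have hpos : 0 < Module.finrank K (LinearMap.ker D) :=
        Submodule.one_le_finrank_iff.2 ((Submodule.ne_bot_iff _).2
          ⟨_, hker, fun h => hg0 (congrArg Subtype.val h)⟩)
      have := D.finrank_range_add_finrank_ker
      omega
    obtain ⟨q, hq0, hq⟩ := ih (LinearMap.range D) (by omega)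
    refine ⟨q * g, mul_ne_zero hq0 hg0, fun p hp f hf hdvd => ?_⟩
    rw [eval_mul] at hp
    refine eq_zero_of_wronskian_eq_zero (g := g) (p := p) ?_ (right_ne_zero_of_mul hp) ?_
    · refine hq p (left_ne_zero_of_mul hp) _ ⟨⟨f, hf⟩, rfl⟩ ?_
      have hd : (X - C p) ^ k ∣ derivative f := by
        simpa using pow_sub_one_dvd_derivative_of_pow_dvd hdvd
      exact dvd_sub (hd.mul_left _) (((pow_dvd_pow _ k.le_succ).trans hdvd).mul_left _)
    · exact dvd_iff_isRoot.1 ((dvd_pow_self _ k.succ_ne_zero).trans hdvd)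

/-- Linear independence is an open condition in one-parameter polynomial families. -/
theorem exists_forall_linearIndependent_eval {Q : Type*} [CommRing Q] [Algebra K Q] {r : ℕ}
    (F : Fin r → Q[X]) (p₀ : K)
    (h : LinearIndependent K fun i => (F i).eval (algebraMap K Q p₀)) :
    ∃ q : K[X], q ≠ 0 ∧ ∀ p, q.eval p ≠ 0 →
      LinearIndependent K fun i => (F i).eval (algebraMap K Q p) := by
  obtain ⟨L, hL⟩ := (Fintype.linearCombination K
    fun i => (F i).eval (algebraMap K Q p₀)).exists_leftInverse_of_injective
      (LinearMap.ker_eq_bot'.2 fun c hc => by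
        ext i
        exact Fintype.linearIndependent_iff.1 h c hc i)
  -- `L` is a left inverse at `p₀`, so `N` is the identity there; independence persists wherever
  -- `det N` is nonzero.
  let N : Matrix (Fin r) (Fin r) K[X] := fun i j => (F i).sum fun k a => C (L a j) * X ^ k
  have hN : ∀ p, N.map (eval p) = fun i => L ((F i).eval (algebraMap K Q p)) := by
    intro p
    funext i j
    change eval p ((F i).sum fun k a => C (L a j) * X ^ k) = _
    rw [Polynomial.sum, eval_finsetSum]
    simp only [eval_mul, eval_C, eval_pow, eval_X]
    rw [eval_eq_sum, Polynomial.sum, map_sum, Finset.sum_apply]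
    refine Finset.sum_congr rfl fun k _ => ?_
    rw [← map_pow, mul_comm (coeff _ _), ← Algebra.smul_def, map_smul, Pi.smul_apply,
      smul_eq_mul, mul_comm]
  have hdet : ∀ p, N.det.eval p = (N.map (eval p)).det := fun p =>
    (evalRingHom p).map_det N
  have hp₀ : N.det.eval p₀ = 1 := by
    rw [hdet, hN]
    have : (fun i => L ((F i).eval (algebraMap K Q p₀))) = (1 : Matrix (Fin r) (Fin r) K) := by
      funext i
      have := LinearMap.congr_fun hL (Pi.single i 1)
      rw [LinearMap.comp_apply, Fintype.linearCombination_apply_single, one_smul] at this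
      rw [this]
      ext j
      simp [Matrix.one_apply, Pi.single_apply, eq_comm]
    rw [this, Matrix.det_one]
  refine ⟨N.det, fun h0 => ?_, fun p hp => ?_⟩
  · rw [h0, eval_zero] at hp₀
    exact zero_ne_one hp₀
  · rw [hdet, hN] at hp
    exact LinearIndependent.of_comp L (Matrix.linearIndependent_rows_of_det_ne_zero hp)

theorem exists_eval_ne_zero_of_ne_zero [Infinite K] {q : K[X]} (hq : q ≠ 0) : ∃ p, q.eval p ≠ 0 := by
  by_contra! h
  exact hq (Polynomial.funext fun p => by rw [h p, eval_zero])

end Univariate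

end Polynomial

namespace Lefschetz

/-! ### Polynomial paths of matrices. -/

section Path

variable {K : Type*} [Field K] {n : ℕ}

theorem eval_aeval_matrix (G : Matrix (Fin n) (Fin n) (Polynomial K))
    (P : MvPolynomial (Fin n × Fin n) K) (p : K) :
    (aeval (fun ij : Fin n × Fin n => G ij.1 ij.2) P).eval p =
      eval (fun ij : Fin n × Fin n => (G ij.1 ij.2).eval p) P := by
  rw [← Polynomial.coe_aeval_eq_eval, comp_aeval_apply]
  rfl

/-- A polynomial path of matrices starting at the identity stays, for almost all parameters, in
a given Zariski neighbourhood. -/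
theorem exists_forall_eval_mul_ne_zero (H : Matrix (Fin n) (Fin n) (Polynomial K))
    (hH : H.map (Polynomial.eval 0) = 1) (g₀ : GL (Fin n) K) (P : MvPolynomial (Fin n × Fin n) K)
    (hP : eval (fun ij : Fin n × Fin n => g₀ ij.1 ij.2) P ≠ 0) :
    ∃ q : Polynomial K, q ≠ 0 ∧ ∀ p, q.eval p ≠ 0 → ∃ h : GL (Fin n) K,
      (h : Matrix (Fin n) (Fin n) K) = H.map (Polynomial.eval p) ∧
      eval (fun ij : Fin n × Fin n => (g₀ * h) ij.1 ij.2) P ≠ 0 := by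
  set G := (g₀ : Matrix (Fin n) (Fin n) K).map Polynomial.C * H with hG
  have hGp : ∀ p, G.map (Polynomial.eval p) =
      (g₀ : Matrix (Fin n) (Fin n) K) * H.map (Polynomial.eval p) := by
    intro p
    have := Matrix.map_mul (L := (g₀ : Matrix (Fin n) (Fin n) K).map Polynomial.C) (M := H)
      (f := Polynomial.evalRingHom p)
    rw [Polynomial.coe_evalRingHom] at this
    rw [hG, this]
    congr 1
    ext i j
    simp
  have hdet : ∀ p, H.det.eval p = (H.map (Polynomial.eval p)).det := fun p =>
    (Polynomial.evalRingHom p).map_det H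
  have hGe : ∀ p, (aeval (fun ij : Fin n × Fin n => G ij.1 ij.2) P).eval p =
      eval (fun ij : Fin n × Fin n =>
        ((g₀ : Matrix (Fin n) (Fin n) K) * H.map (Polynomial.eval p)) ij.1 ij.2) P := by
    intro p
    rw [eval_aeval_matrix, ← hGp]
    rfl
  -- At the parameter `0` this product is the value of `P` at `g₀`. The factor `H.det` keeps the
  -- path inside `GL`.
  refine ⟨aeval (fun ij : Fin n × Fin n => G ij.1 ij.2) P * H.det, fun h0 => ?_, fun p hp => ?_⟩
  · have := congrArg (Polynomial.eval 0) h0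
    rw [Polynomial.eval_mul, hGe, hdet, hH, mul_one, Matrix.det_one, mul_one,
      Polynomial.eval_zero] at this
    exact hP this
  · rw [Polynomial.eval_mul, hGe, hdet] at hp
    exact ⟨Matrix.GeneralLinearGroup.mkOfDetNeZero _ (right_ne_zero_of_mul hp), rfl,
      left_ne_zero_of_mul hp⟩

end Path

/-! ### Full rank of multiplication by powers of a linear form. -/

section FullRank

variable {K : Type*} [Field K] {n : ℕ}

/-- Multiplication by `ℓ ^ s` from the component of degree `i` of `S / I` to that of degree `i + s`
is injective or surjective. -/
def MulPowFullRank (I : Ideal (MvPolynomial (Fin n) K)) (ℓ : MvPolynomial (Fin n) K)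
    (i s : ℕ) : Prop :=
  (∀ f : MvPolynomial (Fin n) K, f.IsHomogeneous i → ℓ ^ s * f ∈ I → f ∈ I) ∨
    ∀ v : MvPolynomial (Fin n) K, v.IsHomogeneous (i + s) →
      ∃ f : MvPolynomial (Fin n) K, f.IsHomogeneous i ∧ v - ℓ ^ s * f ∈ I

instance finiteDimensional_quotientComponent (I : Ideal (MvPolynomial (Fin n) K)) (i : ℕ) :
    FiniteDimensional K (quotientComponent I i) := by
  unfold quotientComponent
  infer_instance

theorem mulPowFullRank_of_min_le_finrank {I : Ideal (MvPolynomial (Fin n) K)}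
    {ℓ : MvPolynomial (Fin n) K} (hℓ : ℓ.IsHomogeneous 1) {i s : ℕ}
    (h : min (Module.finrank K (quotientComponent I i))
        (Module.finrank K (quotientComponent I (i + s))) ≤
      Module.finrank K ↥((quotientComponent I i).map
        (LinearMap.mulLeft K ((Ideal.Quotient.mkₐ K I ℓ) ^ s)))) :
    MulPowFullRank I ℓ i s := by
  set T := LinearMap.mulLeft K ((Ideal.Quotient.mkₐ K I ℓ) ^ s) with hT
  have hTf : ∀ f, T (Ideal.Quotient.mkₐ K I f) = Ideal.Quotient.mkₐ K I (ℓ ^ s * f) := fun f => by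
    rw [hT, LinearMap.mulLeft_apply, map_mul, map_pow]
  rcases min_le_iff.1 h with h | h
  · left
    intro f hf hfI
    have hrange : (quotientComponent I i).map T =
        LinearMap.range (T.domRestrict (quotientComponent I i)) := by
      rw [LinearMap.range_domRestrict]
    have hker := (T.domRestrict (quotientComponent I i)).finrank_range_add_finrank_ker
    rw [← hrange] at hker
    have hbot : LinearMap.ker (T.domRestrict (quotientComponent I i)) = ⊥ :=
      Submodule.finrank_eq_zero.1 (by omega)
    have hmem : (⟨Ideal.Quotient.mkₐ K I f, f, hf, rfl⟩ : quotientComponent I i) ∈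
        LinearMap.ker (T.domRestrict (quotientComponent I i)) := by
      rw [LinearMap.mem_ker, LinearMap.domRestrict_apply, hTf]
      exact Ideal.Quotient.eq_zero_iff_mem.2 hfI
    rw [hbot, Submodule.mem_bot] at hmem
    exact Ideal.Quotient.eq_zero_iff_mem.1 (congrArg Subtype.val hmem)
  · right
    intro v hv
    have hle : (quotientComponent I i).map T ≤ quotientComponent I (i + s) := by
      rintro _ ⟨_, ⟨f, hf, rfl⟩, rfl⟩
      refine ⟨ℓ ^ s * f, ?_, (hTf f).symm⟩
      have := (hℓ.pow s).mul hf
      rwa [one_mul, add_comm] at this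
    have heq := Submodule.eq_of_le_of_finrank_le hle h
    have hmem : Ideal.Quotient.mkₐ K I v ∈ quotientComponent I (i + s) := ⟨v, hv, rfl⟩
    rw [← heq] at hmem
    obtain ⟨_, ⟨f, hf, rfl⟩, hfv⟩ := hmem
    refine ⟨f, hf, Ideal.Quotient.eq.1 ?_⟩
    exact hfv.symm.trans (hTf f)

/-- The rank of a power of a linear form does not drop at a general point of a line. -/
theorem exists_forall_finrank_le_finrank {Q : Type*} [CommRing Q] [Algebra K Q]
    (V : Submodule K Q) [FiniteDimensional K V] (u v : Q) (s : ℕ) :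
    ∃ q : Polynomial K, q ≠ 0 ∧ ∀ p, q.eval p ≠ 0 →
      Module.finrank K ↥(V.map (LinearMap.mulLeft K (v ^ s))) ≤
      Module.finrank K ↥(V.map (LinearMap.mulLeft K (((1 - p) • u + p • v) ^ s))) := by
  let b := Module.finBasis K ↥(V.map (LinearMap.mulLeft K (v ^ s)))
  have hb : ∀ j, ∃ w ∈ V, v ^ s * w = (b j).1 := fun j => (b j).2
  choose w hwV hw using hb
  let F : Fin (Module.finrank K ↥(V.map (LinearMap.mulLeft K (v ^ s)))) → Polynomial Q := fun j =>
    ((1 - Polynomial.X) * Polynomial.C u + Polynomial.X * Polynomial.C v) ^ s * Polynomial.C (w j)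
  have hF : ∀ p j, (F j).eval (algebraMap K Q p) = ((1 - p) • u + p • v) ^ s * w j := by
    intro p j
    simp only [F, Polynomial.eval_mul, Polynomial.eval_pow, Polynomial.eval_add,
      Polynomial.eval_sub, Polynomial.eval_one, Polynomial.eval_X, Polynomial.eval_C]
    rw [Algebra.smul_def, Algebra.smul_def, map_sub, map_one]
  obtain ⟨q, hq0, hq⟩ := Polynomial.exists_forall_linearIndependent_eval F (1 : K) (by
    simp only [hF, sub_self, zero_smul, zero_add, one_smul, hw]
    exact b.linearIndependent.map' (Submodule.subtype _) (Submodule.ker_subtype _))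
  refine ⟨q, hq0, fun p hp => ?_⟩
  have hli := hq p hp
  simp only [hF] at hli
  have hli' : LinearIndependent K fun j => (⟨((1 - p) • u + p • v) ^ s * w j, w j, hwV j, rfl⟩ :
      ↥(V.map (LinearMap.mulLeft K (((1 - p) • u + p • v) ^ s)))) :=
    LinearIndependent.of_comp (Submodule.subtype _) hli
  simpa using hli'.fintype_card_le_finrank

theorem MulPowFullRank.map_coordChange {I : Ideal (MvPolynomial (Fin n) K)}
    {ℓ m : MvPolynomial (Fin n) K} {i s : ℕ} (h : MulPowFullRank I ℓ i s) (g : GL (Fin n) K)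
    {c : K} (hc : c ≠ 0) (hm : coordChange g ℓ = c • m) :
    MulPowFullRank (I.map (coordChange g)) m i s := by
  have hcs : c ^ s ≠ 0 := pow_ne_zero s hc
  have hms : m ^ s = (c ^ s)⁻¹ • coordChange g (ℓ ^ s) := by
    rw [map_pow, hm, smul_pow, inv_smul_smul₀ hcs]
  rcases h with h | h
  · left
    intro F hF hFI
    obtain ⟨f, rfl⟩ : ∃ f, coordChange g f = F := ⟨_, coordChange_coordChange_inv g F⟩
    have hf : f.IsHomogeneous i := by
      have := isHomogeneous_coordChange g⁻¹ hF
      rwa [coordChange_inv_coordChange] at this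
    rw [coordChange_mem_map]
    refine h f hf ?_
    have h2 := (I.map (coordChange g)).mul_mem_left (C (c ^ s)) hFI
    rw [← smul_eq_C_mul, hms, smul_mul_assoc, smul_inv_smul₀ hcs, ← map_mul,
      coordChange_mem_map] at h2
    exact h2
  · right
    intro v hv
    obtain ⟨f, hf, hfv⟩ := h _ (isHomogeneous_coordChange g⁻¹ hv)
    refine ⟨c ^ s • coordChange g f,
      (homogeneousSubmodule (Fin n) K i).smul_mem _ (isHomogeneous_coordChange g hf), ?_⟩
    rw [← coordChange_mem_map (g := g), map_sub, coordChange_coordChange_inv, map_mul] at hfv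
    rwa [hms, smul_mul_smul_comm, inv_mul_cancel₀ hcs, one_smul]

end FullRank

/-! ### Moving a Lefschetz element to the last variable. -/

section Ternary

variable {K : Type*} [Field K]

theorem exists_sum_smul_X_of_isHomogeneous_one {f : MvPolynomial (Fin 3) K}
    (hf : f.IsHomogeneous 1) : ∃ a : Fin 3 → K, f = a 0 • X 0 + a 1 • X 1 + a 2 • X 2 := by
  have hf' : f ∈ homogeneousSubmodule (Fin 3) K 1 := hf
  rw [homogeneousSubmodule_one_eq_span_X, Submodule.mem_span_range_iff_exists_fun] at hf'
  obtain ⟨a, rfl⟩ := hf'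
  exact ⟨a, by rw [Fin.sum_univ_three]⟩

/-- Join the form that `g₀` sends to `z` to the Lefschetz element `ℓ` by a line. The rank attained
at `ℓ` is attained at a general point of the line, and a general point also stays in the open set
around `g₀`. As `i` and `s` are fixed, no common choice for all degrees is needed. -/
theorem exists_mulPowFullRank_X_two [Infinite K] {I : Ideal (MvPolynomial (Fin 3) K)}
    (hSLP : HasSLP (quotientComponent I)) {P : MvPolynomial (Fin 3 × Fin 3) K} {g₀ : GL (Fin 3) K}
    (hP : eval (fun ij : Fin 3 × Fin 3 => g₀ ij.1 ij.2) P ≠ 0) (i : ℕ) {s : ℕ} (hs : 1 ≤ s) :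
    ∃ g : GL (Fin 3) K, eval (fun ij : Fin 3 × Fin 3 => g ij.1 ij.2) P ≠ 0 ∧
      MulPowFullRank (I.map (coordChange g)) (X 2) i s := by
  obtain ⟨_, ⟨ℓ, hℓ, rfl⟩, hrank⟩ := hSLP
  replace hrank := hrank i s hs
  obtain ⟨a, ha⟩ := exists_sum_smul_X_of_isHomogeneous_one (isHomogeneous_coordChange g₀ hℓ)
  let c : Polynomial K := 1 - Polynomial.X + Polynomial.X * Polynomial.C (a 2)
  -- Applying `g₀` to the point `m` of the line gives `c z + p (a₀ x + a₁ y)`. This matrix sends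
  -- that form to `c z` and is the identity at `p = 0`; its entries are polynomial because the
  -- scalar `c` is not divided out.
  let H : Matrix (Fin 3) (Fin 3) (Polynomial K) :=
    !![c, 0, 0; 0, c, 0; -Polynomial.X * Polynomial.C (a 0), -Polynomial.X * Polynomial.C (a 1), 1]
  have hc : ∀ p, c.eval p = 1 - p + p * a 2 := fun p => by
    simp only [c, Polynomial.eval_add, Polynomial.eval_sub, Polynomial.eval_mul,
      Polynomial.eval_one, Polynomial.eval_X, Polynomial.eval_C]
  obtain ⟨q₁, hq₁0, hq₁⟩ := exists_forall_eval_mul_ne_zero H (by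
    ext j k; fin_cases j <;> fin_cases k <;> simp [H, hc]) g₀ P hP
  obtain ⟨q₂, hq₂0, hq₂⟩ := exists_forall_finrank_le_finrank (quotientComponent I i)
    (Ideal.Quotient.mkₐ K I (coordChange g₀⁻¹ (X 2))) (Ideal.Quotient.mkₐ K I ℓ) s
  obtain ⟨p, hp⟩ := Polynomial.exists_eval_ne_zero_of_ne_zero
    (mul_ne_zero (mul_ne_zero hq₁0 hq₂0) (show c ≠ 0 from fun h0 => by
      have := hc 0; simp [h0] at this))
  rw [Polynomial.eval_mul, Polynomial.eval_mul] at hp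
  have hcp : 1 - p + p * a 2 ≠ 0 := hc p ▸ right_ne_zero_of_mul hp
  obtain ⟨h, hh, hhP⟩ := hq₁ p (left_ne_zero_of_mul (left_ne_zero_of_mul hp))
  refine ⟨g₀ * h, hhP, ?_⟩
  let m := (1 - p) • coordChange g₀⁻¹ (X 2) + p • ℓ
  have hm : m.IsHomogeneous 1 :=
    (homogeneousSubmodule (Fin 3) K 1).add_mem
      ((homogeneousSubmodule (Fin 3) K 1).smul_mem _
        (isHomogeneous_coordChange _ (isHomogeneous_X _ _)))
      ((homogeneousSubmodule (Fin 3) K 1).smul_mem _ hℓ)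
  have hfull : MulPowFullRank I m i s := by
    refine mulPowFullRank_of_min_le_finrank hm ?_
    rw [map_add, map_smul, map_smul]
    exact hrank.ge.trans (hq₂ p (right_ne_zero_of_mul (left_ne_zero_of_mul hp)))
  refine hfull.map_coordChange (g₀ * h) hcp ?_
  have hmg : coordChange g₀ m = (1 - p) • X 2 + p • (a 0 • X 0 + a 1 • X 1 + a 2 • X 2) := by
    rw [map_add, map_smul, map_smul, coordChange_coordChange_inv, ha]
  rw [← coordChange_coordChange, hmg]
  simp only [map_add, map_smul, coordChange_X, hh, Fin.sum_univ_three]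
  simp [H, hc, smul_eq_C_mul]
  ring

end Ternary

/-! ### Revlex in three variables and division by powers of `z`. -/

section TernaryOrder

variable {K : Type*} [Field K]

theorem degree_fin_three (t : Fin 3 →₀ ℕ) : t.degree = t 0 + t 1 + t 2 := by
  rw [Finsupp.degree_eq_sum, Fin.sum_univ_three]

theorem finsupp_eq_of_degree_eq {t u : Fin 3 →₀ ℕ} (hd : t.degree = u.degree) (h1 : t 1 = u 1)
    (h2 : t 2 = u 2) : t = u := by
  rw [degree_fin_three, degree_fin_three] at hd
  ext i
  fin_cases i
  · change t 0 = u 0; omega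
  · exact h1
  · exact h2

theorem degRevLex_three_lt_iff {t u : Fin 3 →₀ ℕ} (hd : t.degree = u.degree) :
    t ≺[degRevLex 3] u ↔ u 2 < t 2 ∨ u 2 = t 2 ∧ u 1 < t 1 := by
  rw [degRevLex_lt_iff]
  have hd' := hd
  rw [degree_fin_three, degree_fin_three] at hd'
  constructor
  · rintro (h | ⟨-, i, hi, hlt⟩)
    · omega
    · fin_cases i
      -- Equal degrees rule out a difference in `x` alone.
      · have h1 : t 1 = u 1 := hi 1 (by decide)
        have h2 : t 2 = u 2 := hi 2 (by decide)
        have h0 : u 0 < t 0 := hlt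
        omega
      · exact Or.inr ⟨(hi 2 (by decide)).symm, hlt⟩
      · exact Or.inl hlt
  · rintro (h | ⟨h, hlt⟩)
    · exact Or.inr ⟨hd, 2, fun j hj => absurd hj (by omega), h⟩
    · refine Or.inr ⟨hd, 1, fun j hj => ?_, hlt⟩
      obtain rfl : j = 2 := by omega
      exact h.symm

theorem degRevLex_three_le_imp {t u : Fin 3 →₀ ℕ} (hd : t.degree = u.degree)
    (h : t ≼[degRevLex 3] u) : u 2 < t 2 ∨ u 2 = t 2 ∧ u 1 ≤ t 1 := by
  rcases h.lt_or_eq with h | h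
  · have := (degRevLex_three_lt_iff hd).1 h
    omega
  · have := (degRevLex 3).toSyn.injective h
    subst this
    exact Or.inr ⟨rfl, le_rfl⟩

/-- In revlex, a form whose leading term is divisible by `z ^ s` is itself divisible by `z ^ s`, so
injectivity passes to leading terms. In the surjective case `v - z ^ s f` lies in `I`, and its
leading term is `v` because every term of `z ^ s f` has larger `z`-exponent. -/
theorem MulPowFullRank.initialSet {I : Ideal (MvPolynomial (Fin 3) K)}
    (hI : I.IsHomogeneous (homogeneousSubmodule (Fin 3) K)) {i s : ℕ}
    (h : MulPowFullRank I (X 2) i s) :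
    (∀ u : Fin 3 →₀ ℕ, u.degree = i → u + Finsupp.single 2 s ∈ initialSet I → u ∈ initialSet I) ∨
      ∀ v : Fin 3 →₀ ℕ, v.degree = i + s → v 2 < s → v ∈ initialSet I := by
  rcases h with h | h
  · left
    rintro u rfl hu
    obtain ⟨F, hFI, hFd, hF0, hFt⟩ := exists_isHomogeneous_of_mem_initialSet hI hu
    have hdvd : monomial (Finsupp.single 2 s) (1 : K) ∣ F := by
      rw [monomial_one_dvd_iff_modMonomial_eq_zero]
      ext w
      rw [coeff_zero]
      by_cases hw : Finsupp.single 2 s ≤ w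
      · exact coeff_modMonomial_of_le _ hw
      · rw [coeff_modMonomial_of_not_le _ hw]
        by_contra hc
        refine hw ?_
        have hle := hFt ▸ (degRevLex 3).le_degree (mem_support_iff.2 hc)
        have hwd : w.degree = (u + Finsupp.single 2 s).degree := by
          by_contra hne
          exact hc (hFd.coeff_eq_zero hne)
        have := degRevLex_three_le_imp hwd hle
        rw [Finsupp.single_le_iff]
        simp only [Finsupp.add_apply, Finsupp.single_eq_same] at this
        omega
    obtain ⟨G, rfl⟩ := hdvd
    have hcoeff : ∀ w, coeff (w + Finsupp.single 2 s)
        (monomial (Finsupp.single 2 s) (1 : K) * G) = coeff w G := fun w => by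
      rw [mul_comm, coeff_mul_monomial, mul_one]
    have hGd : G.IsHomogeneous u.degree := by
      intro w hw
      rw [← hcoeff] at hw
      have := hFd hw
      have hweight : ∀ v : Fin 3 →₀ ℕ, Finsupp.weight (1 : Fin 3 → ℕ) v = v.degree := fun v => by
        rw [Finsupp.degree_eq_weight_one]
        rfl
      rw [hweight] at this ⊢
      rw [map_add, map_add] at this
      exact Nat.add_right_cancel this
    have hGu : coeff u G ≠ 0 := by
      rw [← hcoeff]
      exact coeff_ne_zero_of_degree_eq hF0 hFt
    refine ⟨G, h G hGd ?_, fun h0 => hGu (by rw [h0, coeff_zero]), degree_eq_of_coeff hGu ?_⟩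
    · rw [X_pow_eq_monomial]
      exact hFI
    · intro w hw
      rw [← hcoeff] at hw
      have hle := (degRevLex 3).le_degree (mem_support_iff.2 hw)
      rw [hFt, map_add, map_add] at hle
      exact le_of_add_le_add_right hle
  · right
    intro v hv hvs
    obtain ⟨f, hf, hfv⟩ := h (monomial v 1) (isHomogeneous_monomial 1 hv)
    have hcoeff : ∀ w, coeff w (X 2 ^ s * f) ≠ 0 → s ≤ w 2 ∧ w.degree = i + s := by
      intro w hw
      refine ⟨?_, ?_⟩
      · rw [X_pow_eq_monomial, coeff_monomial_mul'] at hw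
        split_ifs at hw with hle
        · exact Finsupp.single_le_iff.1 hle
        · exact absurd rfl hw
      · by_contra hne
        have hd := (isHomogeneous_X_pow (R := K) (2 : Fin 3) s).mul hf
        exact hw (hd.coeff_eq_zero (by omega))
    have hv0 : coeff v (X 2 ^ s * f) = 0 := by
      by_contra hne
      have := (hcoeff v hne).1
      omega
    have hvc : coeff v (monomial v (1 : K) - X 2 ^ s * f) ≠ 0 := by
      rw [coeff_sub, hv0, coeff_monomial, if_pos rfl, sub_zero]
      exact one_ne_zero
    refine ⟨_, hfv, fun h0 => hvc (by rw [h0, coeff_zero]), degree_eq_of_coeff hvc ?_⟩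
    intro w hw
    rcases eq_or_ne v w with rfl | hne
    · exact le_rfl
    · rw [coeff_sub, coeff_monomial, if_neg hne, zero_sub, neg_ne_zero] at hw
      have := hcoeff w hw
      exact le_of_lt ((degRevLex_three_lt_iff (this.2.trans hv.symm)).2 (Or.inl (by omega)))

end TernaryOrder

/-! ### Dehomogenized forms and orders of vanishing. -/

section Dehomogenization

variable {K : Type*} [Field K]

/-- Set `x = 1` and regard the result as a polynomial in `z` over polynomials in `y`. -/
noncomputable def dehomogenize (K : Type*) [Field K] :
    MvPolynomial (Fin 3) K →ₐ[K] Polynomial (Polynomial K) :=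
  aeval ![1, Polynomial.C Polynomial.X, Polynomial.X]

theorem coeff_coeff_dehomogenize_monomial (u : Fin 3 →₀ ℕ) (a : K) (b c : ℕ) :
    ((dehomogenize K (monomial u a)).coeff c).coeff b = if u 1 = b ∧ u 2 = c then a else 0 := by
  have : dehomogenize K (monomial u a) =
      Polynomial.monomial (u 2) (Polynomial.monomial (u 1) a) := by
    rw [dehomogenize, aeval_monomial, Finsupp.prod_fintype _ _ (by simp), Fin.prod_univ_three]
    simp only [Matrix.cons_val_zero, Matrix.cons_val_one, Matrix.cons_val, one_pow, one_mul]
    rw [← Polynomial.C_mul_X_pow_eq_monomial, ← Polynomial.C_mul_X_pow_eq_monomial, map_mul,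
      map_pow, ← mul_assoc]
    rfl
  rw [this, Polynomial.coeff_monomial]
  by_cases hc : u 2 = c <;> by_cases hb : u 1 = b <;> simp [hb, hc, Polynomial.coeff_monomial]

theorem coeff_coeff_dehomogenize (F : MvPolynomial (Fin 3) K) (b c : ℕ) :
    ((dehomogenize K F).coeff c).coeff b =
      ∑ u ∈ F.support, if u 1 = b ∧ u 2 = c then coeff u F else 0 := by
  conv_lhs => rw [F.as_sum]
  simp only [map_sum, Polynomial.finsetSum_coeff, coeff_coeff_dehomogenize_monomial]

/-- In a fixed degree the exponents of `y` and `z` determine that of `x`, so no two terms merge. -/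
theorem coeff_coeff_dehomogenize_of_isHomogeneous {F : MvPolynomial (Fin 3) K} {t : Fin 3 →₀ ℕ}
    (hF : F.IsHomogeneous t.degree) :
    ((dehomogenize K F).coeff (t 2)).coeff (t 1) = coeff t F := by
  rw [coeff_coeff_dehomogenize, Finset.sum_eq_single t, if_pos ⟨rfl, rfl⟩]
  · intro u hu hut
    rw [if_neg]
    rintro ⟨h1, h2⟩
    refine hut (finsupp_eq_of_degree_eq ?_ h1 h2)
    by_contra hne
    exact mem_support_iff.1 hu (hF.coeff_eq_zero hne)
  · intro ht
    rw [if_pos ⟨rfl, rfl⟩, notMem_support_iff.1 ht]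

theorem exists_of_coeff_coeff_dehomogenize_ne_zero {F : MvPolynomial (Fin 3) K} {b c : ℕ}
    (h : ((dehomogenize K F).coeff c).coeff b ≠ 0) :
    ∃ u, coeff u F ≠ 0 ∧ u 1 = b ∧ u 2 = c := by
  rw [coeff_coeff_dehomogenize] at h
  obtain ⟨u, hu, hu'⟩ := Finset.exists_ne_zero_of_sum_ne_zero h
  split_ifs at hu' with hbc
  · exact ⟨u, hu', hbc⟩
  · exact absurd rfl hu'

variable {F : MvPolynomial (Fin 3) K} {t : Fin 3 →₀ ℕ}

theorem le_of_coeff_coeff_dehomogenize_ne_zero (hF : F.IsHomogeneous t.degree)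
    (hFt : (degRevLex 3).degree F = t) {b c : ℕ}
    (h : ((dehomogenize K F).coeff c).coeff b ≠ 0) : t 2 < c ∨ t 2 = c ∧ t 1 ≤ b := by
  obtain ⟨u, hu, rfl, rfl⟩ := exists_of_coeff_coeff_dehomogenize_ne_zero h
  refine degRevLex_three_le_imp ?_ (hFt ▸ (degRevLex 3).le_degree (mem_support_iff.2 hu))
  by_contra hne
  exact hu (hF.coeff_eq_zero hne)

theorem coeff_dehomogenize_eq_zero_of_lt (hF : F.IsHomogeneous t.degree)
    (hFt : (degRevLex 3).degree F = t) {c : ℕ} (hc : c < t 2) :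
    (dehomogenize K F).coeff c = 0 := by
  ext b
  by_contra hne
  have := le_of_coeff_coeff_dehomogenize_ne_zero hF hFt hne
  omega

theorem X_pow_dvd_coeff_dehomogenize (hF : F.IsHomogeneous t.degree)
    (hFt : (degRevLex 3).degree F = t) :
    Polynomial.X ^ t 1 ∣ (dehomogenize K F).coeff (t 2) := by
  rw [Polynomial.X_pow_dvd_iff]
  intro b hb
  by_contra hne
  have := le_of_coeff_coeff_dehomogenize_ne_zero hF hFt hne
  omega

/-- The coefficients of `z ^ c` in the dehomogenizations of the forms of degree `d` in `I` that
are divisible by `z ^ c`. -/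
noncomputable def lowestCoeffs (I : Ideal (MvPolynomial (Fin 3) K)) (d c : ℕ) :
    Submodule K (Polynomial K) where
  carrier := {f | ∃ F ∈ I, F.IsHomogeneous d ∧ (∀ j < c, (dehomogenize K F).coeff j = 0) ∧
    (dehomogenize K F).coeff c = f}
  zero_mem' := ⟨0, I.zero_mem, isHomogeneous_zero _ _ _, by simp, by simp⟩
  add_mem' := by
    rintro _ _ ⟨F, hF, hFd, hFj, rfl⟩ ⟨G, hG, hGd, hGj, rfl⟩
    refine ⟨F + G, I.add_mem hF hG, hFd.add hGd, fun j hj => ?_, ?_⟩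
    · rw [map_add, Polynomial.coeff_add, hFj j hj, hGj j hj, add_zero]
    · rw [map_add, Polynomial.coeff_add]
  smul_mem' := by
    rintro a _ ⟨F, hF, hFd, hFj, rfl⟩
    refine ⟨a • F, (I.restrictScalars K).smul_mem a hF,
      (homogeneousSubmodule (Fin 3) K d).smul_mem a hFd, fun j hj => ?_, ?_⟩
    · rw [map_smul, Polynomial.coeff_smul, hFj j hj, smul_zero]
    · rw [map_smul, Polynomial.coeff_smul]

instance finiteDimensional_lowestCoeffs (I : Ideal (MvPolynomial (Fin 3) K)) (d c : ℕ) :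
    FiniteDimensional K (lowestCoeffs I d c) := by
  let L : MvPolynomial (Fin 3) K →ₗ[K] Polynomial K :=
    ((Polynomial.lcoeff (Polynomial K) c).restrictScalars K) ∘ₗ (dehomogenize K).toLinearMap
  refine Submodule.finiteDimensional_of_le
    (S₂ := (homogeneousSubmodule (Fin 3) K d).map L) ?_
  rintro _ ⟨F, -, hFd, -, rfl⟩
  exact ⟨F, hFd, rfl⟩

/-- The exponents of `y` in the leading terms of degree `d` in which `z` has exponent `c`. -/
def initialSlice (M : Set (Fin 3 →₀ ℕ)) (d c : ℕ) : Set ℕ :=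
  {b | ∃ t ∈ M, t.degree = d ∧ t 1 = b ∧ t 2 = c}

/-- If the coefficient of `z ^ c` is the lowest nonzero one, the leading term has `z`-exponent `c`
and its `y`-exponent lies in the slice. A nonzero element is therefore detected by its coefficients
there. -/
theorem finrank_lowestCoeffs_le {I : Ideal (MvPolynomial (Fin 3) K)} (d c : ℕ) :
    Module.finrank K (lowestCoeffs I d c) ≤ (initialSlice (initialSet I) d c).ncard := by
  have hfin : (initialSlice (initialSet I) d c).Finite := by
    refine (Set.finite_Iic d).subset ?_
    rintro _ ⟨t, -, rfl, rfl, -⟩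
    rw [Set.mem_Iic, degree_fin_three]
    omega
  have := hfin.fintype
  let L : lowestCoeffs I d c →ₗ[K] (initialSlice (initialSet I) d c → K) :=
    (LinearMap.pi fun b => Polynomial.lcoeff K b.1) ∘ₗ Submodule.subtype _
  have hL : Function.Injective L := by
    rw [injective_iff_map_eq_zero]
    rintro ⟨f, F, hF, hFd, hFj, rfl⟩ h0
    by_contra hne
    have hc0 : (dehomogenize K F).coeff c ≠ 0 := fun h => hne (Subtype.ext h)
    have hF0 : F ≠ 0 := fun h => hc0 (by rw [h, map_zero, Polynomial.coeff_zero])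
    obtain ⟨t, ht⟩ : ∃ t, (degRevLex 3).degree F = t := ⟨_, rfl⟩
    have htd : t.degree = d := ht ▸ degree_degree_of_isHomogeneous hFd hF0
    rw [← htd] at hFd
    have hlead : ((dehomogenize K F).coeff (t 2)).coeff (t 1) ≠ 0 := by
      rw [coeff_coeff_dehomogenize_of_isHomogeneous hFd]
      exact coeff_ne_zero_of_degree_eq hF0 ht
    have htc : t 2 = c := by
      apply le_antisymm
      · by_contra! hlt
        exact hc0 (coeff_dehomogenize_eq_zero_of_lt hFd ht hlt)
      · by_contra! hlt
        rw [hFj _ hlt] at hlead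
        exact hlead rfl
    rw [htc] at hlead
    exact hlead (congrFun h0 ⟨t 1, t, ⟨F, hF, hF0, ht⟩, htd, rfl, htc⟩)
  have := LinearMap.finrank_le_finrank_of_injective hL
  rwa [Module.finrank_fintype_fun_eq_card, ← Set.toFinset_card,
    ← Set.ncard_eq_toFinset_card'] at this

theorem dehomogenize_coordChange {h : GL (Fin 3) K} {p : K}
    (hh : (h : Matrix (Fin 3) (Fin 3) K) = !![1, 0, 0; p, 1, 0; 0, 0, 1])
    (F : MvPolynomial (Fin 3) K) (j : ℕ) :
    (dehomogenize K (coordChange h F)).coeff j =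
      Polynomial.taylor p ((dehomogenize K F).coeff j) := by
  have : (dehomogenize K).comp (coordChange h) =
      (Polynomial.mapAlgHom (Polynomial.taylorAlgHom p)).comp (dehomogenize K) := by
    refine MvPolynomial.algHom_ext fun i => ?_
    fin_cases i <;>
      simp [dehomogenize, coordChange_X, hh, Fin.sum_univ_three, Polynomial.taylor_X, add_comm]
  have hF := DFunLike.congr_fun this F
  rw [AlgHom.comp_apply, AlgHom.comp_apply] at hF
  rw [hF, Polynomial.coe_mapAlgHom, Polynomial.coeff_map]
  rfl

/-- The `y`-exponent `b` of a leading term is the order at `0` of the lowest coefficient in `z`.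
With `x = 1` the coordinate change is the translation by `p`, and undoing it moves this zero to `p`.
-/
theorem exists_mem_lowestCoeffs_pow_dvd {I : Ideal (MvPolynomial (Fin 3) K)}
    (hI : I.IsHomogeneous (homogeneousSubmodule (Fin 3) K)) {h : GL (Fin 3) K} {p : K}
    (hh : (h : Matrix (Fin 3) (Fin 3) K) = !![1, 0, 0; p, 1, 0; 0, 0, 1]) {d c b : ℕ}
    (hb : b ∈ initialSlice (initialSet (I.map (coordChange h))) d c) :
    ∃ f ∈ lowestCoeffs I d c, f ≠ 0 ∧ (Polynomial.X - Polynomial.C p) ^ b ∣ f := by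
  obtain ⟨t, ht, rfl, rfl, rfl⟩ := hb
  obtain ⟨F', hF', hFd', hF0', hFt'⟩ :=
    exists_isHomogeneous_of_mem_initialSet (isHomogeneous_map_coordChange h hI) ht
  obtain ⟨F, hF, rfl⟩ := mem_map_coordChange.1 hF'
  have hFd : F.IsHomogeneous t.degree := by
    have := isHomogeneous_coordChange h⁻¹ hFd'
    rwa [coordChange_inv_coordChange] at this
  have hlead : (dehomogenize K (coordChange h F)).coeff (t 2) ≠ 0 := fun h0 => by
    have := coeff_coeff_dehomogenize_of_isHomogeneous hFd'
    rw [h0, Polynomial.coeff_zero] at this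
    exact coeff_ne_zero_of_degree_eq hF0' hFt' this.symm
  refine ⟨(dehomogenize K F).coeff (t 2), ⟨F, hF, hFd, fun j hj => ?_, rfl⟩, fun h0 => ?_, ?_⟩
  · have := coeff_dehomogenize_eq_zero_of_lt hFd' hFt' hj
    rwa [dehomogenize_coordChange hh, Polynomial.taylor_eq_zero] at this
  · rw [dehomogenize_coordChange hh, h0, map_zero] at hlead
    exact hlead rfl
  · obtain ⟨w, hw⟩ := X_pow_dvd_coeff_dehomogenize hFd' hFt'
    rw [dehomogenize_coordChange hh] at hw
    refine ⟨Polynomial.taylor (-p) w, ?_⟩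
    have := congrArg (Polynomial.taylor (-p)) hw
    rwa [Polynomial.taylor_taylor, neg_add_cancel, Polynomial.taylor_zero, Polynomial.taylor_mul,
      Polynomial.taylor_X_pow, map_neg, ← sub_eq_add_neg] at this

end Dehomogenization

/-! ### The generic initial ideal is almost revlex. -/

section Main

variable {K : Type*} [Field K]

/-- Generic initial ideals are stable under replacing `y` by `x`, in characteristic zero. -/
theorem mem_of_generic_of_le [CharZero K] {I : Ideal (MvPolynomial (Fin 3) K)}
    (hI : I.IsHomogeneous (homogeneousSubmodule (Fin 3) K)) {P : MvPolynomial (Fin 3 × Fin 3) K}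
    {M : Set (Fin 3 →₀ ℕ)}
    (hM : ∀ g : GL (Fin 3) K, eval (fun ij : Fin 3 × Fin 3 => g ij.1 ij.2) P ≠ 0 →
      initialSet (I.map (coordChange g)) = M) {g₀ : GL (Fin 3) K}
    (hP : eval (fun ij : Fin 3 × Fin 3 => g₀ ij.1 ij.2) P ≠ 0) {t t' : Fin 3 →₀ ℕ} (ht : t ∈ M)
    (hd : t'.degree = t.degree) (h1 : t' 1 ≤ t 1) (h2 : t' 2 = t 2) : t' ∈ M := by
  set I₁ := I.map (coordChange g₀) with hI₁
  have hI₁h := isHomogeneous_map_coordChange g₀ hI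
  set d := t.degree with hd_def
  set c := t 2 with hc_def
  set k := Module.finrank K (lowestCoeffs I₁ d c) with hk
  obtain ⟨q₁, hq₁0, hq₁⟩ :=
    Polynomial.exists_forall_pow_dvd_imp_eq_zero k (lowestCoeffs I₁ d c) le_rfl
  obtain ⟨q₂, hq₂0, hq₂⟩ := exists_forall_eval_mul_ne_zero
    !![1, 0, 0; Polynomial.X, 1, 0; 0, 0, 1]
    (by ext j k; fin_cases j <;> fin_cases k <;> simp) g₀ P hP
  obtain ⟨p, hp⟩ := Polynomial.exists_eval_ne_zero_of_ne_zero (mul_ne_zero hq₁0 hq₂0)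
  rw [Polynomial.eval_mul] at hp
  obtain ⟨h, hh, hhP⟩ := hq₂ p (right_ne_zero_of_mul hp)
  have hh' : (h : Matrix (Fin 3) (Fin 3) K) = !![1, 0, 0; p, 1, 0; 0, 0, 1] := by
    rw [hh]
    ext j k
    fin_cases j <;> fin_cases k <;> simp
  -- An exponent `b ≥ k` would give a nonzero element of the `k`-dimensional space vanishing to
  -- order `k` at the general point `p`. Since the slice has at least `k` elements, it is all of
  -- `Set.Iio k`.
  have hsub : initialSlice M d c ⊆ Set.Iio k := by
    intro b hb
    rw [← hM _ hhP, map_coordChange_mul] at hb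
    obtain ⟨f, hf, hf0, hdvd⟩ := exists_mem_lowestCoeffs_pow_dvd hI₁h hh' hb
    by_contra hlt
    rw [Set.mem_Iio, not_lt] at hlt
    exact hf0 (hq₁ p (left_ne_zero_of_mul hp) f hf ((pow_dvd_pow _ hlt).trans hdvd))
  have hle : k ≤ (initialSlice M d c).ncard := by
    rw [← hM _ hP]
    exact finrank_lowestCoeffs_le d c
  have heq : initialSlice M d c = Set.Iio k := by
    refine Set.eq_of_subset_of_ncard_le hsub ?_ (Set.finite_Iio k)
    simpa [Set.ncard_eq_toFinset_card'] using hle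
  have htk : t 1 ∈ Set.Iio k := heq ▸ ⟨t, ht, rfl, rfl, rfl⟩
  have ht'k : t' 1 ∈ initialSlice M d c := by
    rw [heq]
    exact lt_of_le_of_lt h1 htk
  obtain ⟨u, hu, hud, hu1, hu2⟩ := ht'k
  rwa [finsupp_eq_of_degree_eq (hd.trans hud.symm) hu1.symm (h2.trans hu2.symm)]

theorem isAlmostRevlex_of_isGin [CharZero K] {I J : Ideal (MvPolynomial (Fin 3) K)}
    (hI : I.IsHomogeneous (homogeneousSubmodule (Fin 3) K)) (hSLP : HasSLP (quotientComponent I))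
    (hJ : IsGin (degRevLex 3) I J) : IsAlmostRevlex J := by
  obtain ⟨_, ⟨Ps, rfl⟩, ⟨g₀, P, hPs, hP⟩, hU⟩ := hJ
  set M := {t : Fin 3 →₀ ℕ | monomial t (1 : K) ∈ J} with hM_def
  have hM : ∀ g : GL (Fin 3) K, eval (fun ij : Fin 3 × Fin 3 => g ij.1 ij.2) P ≠ 0 →
      initialSet (I.map (coordChange g)) = M := by
    intro g hg
    ext t
    rw [hM_def, Set.mem_ofPred_eq, ← hU g ⟨P, hPs, hg⟩, leadingTermIdeal_eq_span,
      monomial_mem_span_iff (isUpperSet_initialSet _)]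
  refine ⟨⟨initialSet (I.map (coordChange g₀)), ?_⟩, fun t ht t' hd hlt => ?_⟩
  · rw [← hU g₀ ⟨P, hPs, hP⟩, leadingTermIdeal_eq_span]
  change t' ∈ M
  have htM : t ∈ M := ht.1
  rcases (degRevLex_three_lt_iff hd.symm).1 hlt with h2 | ⟨h2, h1⟩
  -- The exponent `s = t 2` is positive because `t' 2 < t 2`. The matrix `g` depends on `t`, but its
  -- set of leading exponents is always `M`.
  · obtain ⟨g, hg, hfull⟩ := exists_mulPowFullRank_X_two hSLP hP (t 0 + t 1) (s := t 2) (by omega)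
    have hMg := hfull.initialSet (isHomogeneous_map_coordChange g hI)
    rw [hM g hg] at hMg
    rcases hMg with hinj | hsurj
    · exfalso
      -- In the injective case the proper divisor `t / z ^ (t 2)` would lie in `M`, contradicting
      -- minimality.
      have hut : t.erase 2 + Finsupp.single 2 (t 2) = t := Finsupp.erase_add_single 2 t
      have hu : t.erase 2 ∈ M := by
        refine hinj _ ?_ (by rwa [hut])
        rw [degree_fin_three]
        simp
      have hut' : t.erase 2 ≤ t := by
        conv_rhs => rw [← hut]
        exact le_self_add
      have hle := ht.2 hu hut' 2
      rw [Finsupp.erase_same] at hle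
      omega
    · refine hsurj t' ?_ h2
      rw [hd, degree_fin_three]
  · exact mem_of_generic_of_le hI hM hP htM hd h1.le h2

theorem hilbertFunction_of_isGin {I J : Ideal (MvPolynomial (Fin 3) K)}
    (hI : I.IsHomogeneous (homogeneousSubmodule (Fin 3) K)) (hJ : IsGin (degRevLex 3) I J) :
    hilbertFunction J = hilbertFunction I := by
  obtain ⟨U, -, ⟨g, hg⟩, hU⟩ := hJ
  rw [← hU g hg, hilbertFunction_leadingTermIdeal (isHomogeneous_map_coordChange g hI),
    hilbertFunction_map_coordChange]

end Main

end Lefschetz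

theorem mainTheorem8 {K : Type*} [Field K] [CharZero K]
    (I : Ideal (MvPolynomial (Fin 3) K))
    (hI : I.IsHomogeneous (MvPolynomial.homogeneousSubmodule (Fin 3) K))
    (hSLP : Lefschetz.HasSLP (Lefschetz.quotientComponent I)) :
    -- `rgin I` is well defined
    (∀ J, Lefschetz.IsGin (Lefschetz.degRevLex 3) I J ↔ J = Lefschetz.rgin I) ∧
    -- it is an almost revlex ideal
    Lefschetz.IsAlmostRevlex (Lefschetz.rgin I) ∧
    -- it is the only almost revlex ideal with the Hilbert function of `I`
    Lefschetz.hilbertFunction (Lefschetz.rgin I) = Lefschetz.hilbertFunction I ∧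
    (∀ J : Ideal (MvPolynomial (Fin 3) K), Lefschetz.IsAlmostRevlex J →
      Lefschetz.hilbertFunction J = Lefschetz.hilbertFunction I → J = Lefschetz.rgin I) ∧
    -- ideals as above with the same Hilbert function have the same `rgin`
    (∀ I' : Ideal (MvPolynomial (Fin 3) K),
      I'.IsHomogeneous (MvPolynomial.homogeneousSubmodule (Fin 3) K) →
      Lefschetz.HasSLP (Lefschetz.quotientComponent I') →
      Lefschetz.hilbertFunction I' = Lefschetz.hilbertFunction I →
      Lefschetz.rgin I' = Lefschetz.rgin I) := by
  have hgin := Lefschetz.isGin_rgin hI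
  have hrev := Lefschetz.isAlmostRevlex_of_isGin hI hSLP hgin
  have hhilb := Lefschetz.hilbertFunction_of_isGin hI hgin
  refine ⟨fun J => ⟨fun hJ => hJ.unique hgin, fun hJ => hJ ▸ hgin⟩, hrev, hhilb,
    fun J hJ hJI => hJ.eq_of_hilbertFunction_eq hrev (hJI.trans hhilb.symm),
    fun I' hI' hSLP' hII' => ?_⟩
  have hgin' := Lefschetz.isGin_rgin hI'
  exact (Lefschetz.isAlmostRevlex_of_isGin hI' hSLP' hgin').eq_of_hilbertFunction_eq hrev
    (((Lefschetz.hilbertFunction_of_isGin hI' hgin').trans hII').trans hhilb.symm)
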